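/- **Setting.** Let $v\ge 0$ be an additive cost function on chores. A *bundle collection* of a finite set $M$ of chores is a list $A=(A_1,\dots,A_n)$ of pairwise disjoint (possibly empty) subsets of $M$; it is *complete* if $\bigcup_k A_k=M$. Chores outside $\bigcup_kA_k$ are *unallocated*. $\mathrm{MMS}(M,v,n)$ is the minimum over complete collections of $n$ bundles of the largest bundle cost. Fix a universal ordering, a strict total order of the chores from most to least costly; $B[p]$ is the $p$-th chore of $B$ in it, and $v(B[p])=0$ for $p>|B|$. Bundles are compared lexicographically by $(v(B[1]),v(B[2]),\dots)$. The $k$-th benchmark bundle $B_k$ is a lexicographically maximal subset of cost at most $\tau$ of $M\setminus\bigcup_{j<k}A_j$. The tuple $(M,A,v,\tau)$ is *First Fit Valid* if $\tau\ge \mathrm{MMS}(M,v,n)$ and $A_k\ge_{lex}B_k$ for all $k$. $\mathrm{FFD}(M,v,\tau,n)$ fills $n$ bins one after the other, each time going through the remaining chores from large to small and inserting each one that keeps the cost of the bin at most $\tau$; chores of equal cost may be taken in any order. **Tidy-Up** (input: $(M,A,v,\tau)$ and an unallocated chore $c^*$). Let $\mu_0=\mathrm{MMS}(M,v,|A|)$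 and choose a partition $P$ of $M$ into $|A|$ parts of cost at most $\mu_0$. Remove from $M$, $A$ and $P$: first all unallocated chores other than $c^*$; then all chores of cost less than $v(c^*)$; then every chore $B[p]$ of a bundle $B$ such that $v(\{B[q]:q<p\})\ge \mu_0$. While some bundle $A_k$ dominates some part $P_j$, i.e. there is $f:P_j\to A_k$ with $v(f^{-1}(c'))\le v(c')$ for all $c'\in A_k$: for each $c'\in A_k$, lying in $P_r$, say, move $c'$ to $P_j$ and move $f^{-1}(c')$ to $P_r$ (the chores $c'$ being taken in an order after which $P_j=A_k$); then delete the bundle $A_k$, the part $P_j$ and their chores. Return the remaining chores and bundles. **Reduction** (input: $(M,A,v,\tau)$ and an unallocated chore $c^*$). Apply Tidy-Up. While some bundle costs more than $\tau$, let $A_k$ be the first such bundle and $c_k^*$ its last chore in the universal ordering. Choose a *suitable reduced chore*: a new chore $c_k^\circ$ with $v(c_k^\circ)<v(c_k^*)$ such that, for $M'=(M\setminus\{c_k^*\})\cup\{c_k^\circ\}$ and an output $D$ of $\mathrm{FFD}(M',v,\tau,|A|)$, one has $\bigcup_{j\le k}D_j=\bigl(\bigcup_{j\le k}A_j\setminus\{c_k^*\}\bigr)\cup\{c_k^\circ\}$.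 Replace $M$ by $M'$ and $A$ by $(D_1,\dots,D_k,A_{k+1},\dots,A_{|A|})$, and apply Tidy-Up with the same $c^*$. Return the tuple at the end. (New chores of every cost are available without limit, and $v$ and the universal ordering extend to them.) **Lemma.** Let $(M,A,v,\tau)$ be First Fit Valid with $n=|A|\ge 1$ and $\mathrm{MMS}(M,v,n)=\mu$, let $\tau\ge\frac87\mu$, and let $c^*\in M\setminus\bigcup_kA_k$ be an unallocated chore with $v(c^*)>0$. Then the Reduction algorithm is well defined and terminates: each call of Tidy-Up has an output, a suitable reduced chore exists whenever one is needed, and for all choices that are made there are at most $n$ iterations of its loop. In particular it has an output. For every output $(M',A',v,\tau)$, with $n'=|A'|$: 1. $(M',A',v,\tau)$ is First Fit Valid; 2. $1\le n'\le n$; 3. $\mathrm{MMS}(M',v,n')\le\mu$; 4. $c^*\in M'$ and $c^*\notin\bigcup_kA'_k$; 5. $v(A'_k)\le\tau$ for every $k$. Moreover $A'$ is an output of $\mathrm{FFD}(M',v,\tau,n')$ (for some order of the chores of equal cost), which thus fails to allocate all chores of $M'$. -/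

import Mathlib

open scoped Classical NNReal

noncomputable section

namespace ChoreReduction

/-! ### Bundles, bundle collections and the maximin share -/

/-- The additive cost of a bundle. -/
def cost {C : Type*} (v : C → ℝ) (B : Finset C) : ℝ := ∑ c ∈ B, v c

/-- The union of all bundles of a list of bundles, i.e. the set of allocated chores. -/
def allocated {C : Type*} (A : List (Finset C)) : Finset C := A.foldr (fun B S => B ∪ S) ∅

/-- `A` is an ordered collection of pairwise disjoint (possibly empty) subsets of `M`. -/
structure IsBundleCollection {C : Type*} (M : Finset C) (A : List (Finset C)) : Prop where
  subset : ∀ B ∈ A, B ⊆ M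
  disjoint : A.Pairwise Disjoint

/-- A bundle collection that allocates every chore of `M`. -/
structure IsComplete {C : Type*} (M : Finset C) (A : List (Finset C)) : Prop
    extends IsBundleCollection M A where
  covers : allocated A = M

/-- The largest cost of a bundle in a list (costs are nonnegative, so `0` is a neutral start). -/
def maxCost {C : Type*} (v : C → ℝ) (A : List (Finset C)) : ℝ :=
  (A.map (cost v)).foldr max 0

/-- The maximin share: the minimum, over all complete collections of `n` bundles, of the largest
bundle cost (for `n ≥ 1` this is an infimum of a nonempty finite set). -/
def mms {C : Type*} (v : C → ℝ) (M : Finset C) (n : ℕ) : ℝ :=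
  sInf {x : ℝ | ∃ P : List (Finset C), P.length = n ∧ IsComplete M P ∧ x = maxCost v P}

/-! ### The universal ordering and the lexicographic order on bundles -/

/-- `prec a b` says that `a` comes before `b` in the universal ordering: a strict total order
of the chores from the most costly to the least costly. -/
structure IsUniversalOrdering {C : Type*} (v : C → ℝ) (prec : C → C → Prop) : Prop where
  irrefl : ∀ a, ¬ prec a a
  trans : ∀ a b c, prec a b → prec b c → prec a c
  total : ∀ a b, a ≠ b → prec a b ∨ prec b a
  antitone : ∀ a b, v b < v a → prec a b

/-- `nthCost v B p` is the cost of the `(p+1)`-st largest chore of `B`, and `0` if `B` has at most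
`p` chores. -/
def nthCost {C : Type*} (v : C → ℝ) (B : Finset C) (p : ℕ) : ℝ :=
  ((B.val.map v).sort (· ≥ ·)).getD p 0

def LexEq {C : Type*} (v : C → ℝ) (B₁ B₂ : Finset C) : Prop :=
  ∀ p, nthCost v B₁ p = nthCost v B₂ p

/-- `B₁` is lexicographically at most `B₂`. -/
def LexLE {C : Type*} (v : C → ℝ) (B₁ B₂ : Finset C) : Prop :=
  LexEq v B₁ B₂ ∨
    ∃ q, (∀ p < q, nthCost v B₁ p = nthCost v B₂ p) ∧ nthCost v B₁ q < nthCost v B₂ q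

/-- `B` is a lexicographically maximal subset of `S` with respect to `v` and `τ`. -/
def IsLexMaximal {C : Type*} (v : C → ℝ) (τ : ℝ) (S B : Finset C) : Prop :=
  (B ⊆ S ∧ cost v B ≤ τ) ∧ ∀ B', B' ⊆ S → cost v B' ≤ τ → LexLE v B' B

/-! ### First Fit Valid tuples -/

/-- A set of chores with a list of bundles (the cost function and the threshold are kept as
separate parameters). -/
structure ChoreTuple (C : Type*) where
  items : Finset C
  bundles : List (Finset C)

/-- `B` is a `k`-th benchmark bundle (with indices starting from `0`). -/
def IsBenchmark {C : Type*} (v : C → ℝ) (τ : ℝ) (t : ChoreTuple C) (k : ℕ) (B : Finset C) :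
    Prop :=
  IsLexMaximal v τ (t.items \ allocated (t.bundles.take k)) B

structure FirstFitValid {C : Type*} (v : C → ℝ) (τ : ℝ) (t : ChoreTuple C) : Prop where
  collection : IsBundleCollection t.items t.bundles
  threshold : mms v t.items t.bundles.length ≤ τ
  lex_ge : ∀ k Ak, t.bundles[k]? = some Ak → ∀ B, IsBenchmark v τ t k B → LexLE v B Ak

/-! ### First Fit Decreasing -/

/-- Fill one bin: go through the list and insert every chore that still fits. -/
def ffdBin {C : Type*} (v : C → ℝ) (τ : ℝ) (l : List C) : Finset C :=
  l.foldl (fun B c => if cost v (insert c B) ≤ τ then insert c B else B) ∅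

/-- Fill `n` bins one after the other, each from the chores that remain in the list. -/
def ffd {C : Type*} (v : C → ℝ) (τ : ℝ) : List C → ℕ → List (Finset C)
  | _, 0 => []
  | l, n + 1 => ffdBin v τ l :: ffd v τ (l.filter (fun c => c ∉ ffdBin v τ l)) n

/-- `D` is the output of FFD on the chores `M` with threshold `τ` and `n` bins: the chores are
listed from large to small, with ties between chores of equal cost broken in some way. -/
def IsFFDOutput {C : Type*} (v : C → ℝ) (M : Finset C) (τ : ℝ) (n : ℕ)
    (D : List (Finset C)) : Prop :=
  ∃ l : List C, l.Nodup ∧ l.toFinset = M ∧ l.Pairwise (fun a b => v b ≤ v a) ∧ D = ffd v τ l n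

/-! ### The Tidy-Up Procedure -/

/-- The chore `c` of `B` is `μ`-redundant: the chores of `B` before it already cost `μ`. -/
def IsRedundant {C : Type*} (prec : C → C → Prop) (v : C → ℝ) (μ : ℝ) (B : Finset C) (c : C) :
    Prop :=
  c ∈ B ∧ μ ≤ cost v (B.filter (fun x => prec x c))

/-- `f` maps `B` to `A` in such a way that the preimage of each `c ∈ A` costs at most `v c`. -/
def IsDominationMap {C : Type*} (v : C → ℝ) (A B : Finset C) (f : C → C) : Prop :=
  (∀ c ∈ B, f c ∈ A) ∧ ∀ c ∈ A, cost v (B.filter (fun x => f x = c)) ≤ v c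

def Dominates {C : Type*} (v : C → ℝ) (A B : Finset C) : Prop :=
  ∃ f : C → C, IsDominationMap v A B f

/-- The data that the procedure modifies: the chores, the bundles, and a partition of the chores
into cheap parts. -/
structure TidyState (C : Type*) where
  items : Finset C
  bundles : List (Finset C)
  parts : List (Finset C)

/-- Remove the chores of `R` everywhere. -/
def TidyState.remove {C : Type*} (s : TidyState C) (R : Finset C) : TidyState C where
  items := s.items \ R
  bundles := s.bundles.map (fun B => B \ R)
  parts := s.parts.map (fun Q => Q \ R)

/-- Remove all unallocated chores except `c`. -/
def TidyState.removeUnallocated {C : Type*} (c : C) (s : TidyState C) : TidyState C :=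
  s.remove ((s.items \ allocated s.bundles) \ {c})

/-- Remove all chores that are smaller than `c`. -/
def TidyState.removeSmaller {C : Type*} (v : C → ℝ) (c : C) (s : TidyState C) : TidyState C :=
  s.remove (s.items.filter (fun x => v x < v c))

/-- Remove all `μ`-redundant chores. -/
def TidyState.removeRedundant {C : Type*} (prec : C → C → Prop) (v : C → ℝ) (μ : ℝ)
    (s : TidyState C) : TidyState C :=
  s.remove (s.items.filter (fun x => ∃ B ∈ s.bundles, IsRedundant prec v μ B x))

/-- Move the chores of `S` to the part with index `r`. -/
def moveTo {C : Type*} (P : List (Finset C)) (S : Finset C) (r : ℕ) : List (Finset C) :=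
  (P.map (fun Q => Q \ S)).modify r (fun Q => Q ∪ S)

/-- One round of the exchange loop for the chore `c`, which lies in the part with index `r`, say:
move `c` to the part with index `j`, and move the preimage of `c` under `f : Pj → Ak` to the part
with index `r`. Here `Pj` is the part with index `j` before the loop. -/
def exchangeOne {C : Type*} (f : C → C) (Pj : Finset C) (j : ℕ) (P : List (Finset C)) (c : C) :
    List (Finset C) :=
  let r := P.findIdx (fun Q => decide (c ∈ Q))
  moveTo (moveTo P {c} j) (Pj.filter (fun x => f x = c)) r

/-- The exchange loop over the chores in `order`. -/
def exchange {C : Type*} (f : C → C) (Pj : Finset C) (j : ℕ) (order : List C)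
    (P : List (Finset C)) : List (Finset C) :=
  order.foldl (exchangeOne f Pj j) P

/-- One iteration of the while loop: choose a bundle `Ak` that dominates a part `Pj`, with a
domination mapping `f`; loop over the chores of `Ak`, in an order after which the `j`-th part has
become `Ak`; then remove this bundle and this part. -/
def DominationStep {C : Type*} (v : C → ℝ) (s s' : TidyState C) : Prop :=
  ∃ (k j : ℕ) (Ak Pj : Finset C) (f : C → C) (order : List C),
    s.bundles[k]? = some Ak ∧ s.parts[j]? = some Pj ∧ IsDominationMap v Ak Pj f ∧
    order.Nodup ∧ order.toFinset = Ak ∧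
    (exchange f Pj j order s.parts)[j]? = some Ak ∧
    s' = { items := s.items \ Ak
           bundles := s.bundles.eraseIdx k
           parts := (exchange f Pj j order s.parts).eraseIdx j }

/-- `t'` is an output of the Tidy-Up Procedure on the tuple `t` and the unallocated chore `c`
(for some choice of the partition and of the domination mappings). -/
def TidyUp {C : Type*} (prec : C → C → Prop) (v : C → ℝ) (c : C) (t t' : ChoreTuple C) : Prop :=
  ∃ (P : List (Finset C)) (s : TidyState C),
    P.length = t.bundles.length ∧ IsComplete t.items P ∧
    (∀ Q ∈ P, cost v Q ≤ mms v t.items t.bundles.length) ∧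
    Relation.ReflTransGen (DominationStep v)
      (((TidyState.mk t.items t.bundles P).removeUnallocated c
        |>.removeSmaller v c).removeRedundant prec v (mms v t.items t.bundles.length)) s ∧
    (¬ ∃ Ak ∈ s.bundles, ∃ Pj ∈ s.parts, Dominates v Ak Pj) ∧
    t' = { items := s.items, bundles := s.bundles }

/-! ### The Reduction algorithm -/

/-- `c` is the last chore of `B` in the universal ordering. -/
def IsLastChore {C : Type*} (prec : C → C → Prop) (B : Finset C) (c : C) : Prop :=
  c ∈ B ∧ ∀ x ∈ B, x ≠ c → prec x c

/-- `c` is an excessive chore of the bundle `B`. -/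
def IsExcessive {C : Type*} (prec : C → C → Prop) (v : C → ℝ) (τ : ℝ) (B : Finset C) (c : C) :
    Prop :=
  τ < cost v B ∧ IsLastChore prec B c

def HasExcessive {C : Type*} (prec : C → C → Prop) (v : C → ℝ) (τ : ℝ) (t : ChoreTuple C) :
    Prop :=
  ∃ B ∈ t.bundles, ∃ c, IsExcessive prec v τ B c

/-- Replace the chore `ck` by the chore `c₀`. -/
def replaceChore {C : Type*} (S : Finset C) (ck c₀ : C) : Finset C := insert c₀ (S.erase ck)

/-- The new chore `c₀` is a suitable reduced chore of the chore `ck` in the bundle with index `k`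
(counted from `0`), as witnessed by the FFD output `D`: after the replacement, FFD puts the same
chores into the first `k + 1` bundles. -/
structure IsSuitableReduced {C : Type*} (v : C → ℝ) (τ : ℝ) (t : ChoreTuple C) (k : ℕ)
    (ck c₀ : C) (D : List (Finset C)) : Prop where
  fresh : c₀ ∉ t.items
  smaller : v c₀ < v ck
  isFFD : IsFFDOutput v (replaceChore t.items ck c₀) τ t.bundles.length D
  union_eq : allocated (D.take (k + 1)) =
    replaceChore (allocated (t.bundles.take (k + 1))) ck c₀

/-- The body of the while loop up to the call of the Tidy-Up Procedure: replace the excessive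
chore of the first bundle that has one by a suitable reduced chore, and replace the bundles up to
this one by those of FFD. -/
def ReplaceStep {C : Type*} (prec : C → C → Prop) (v : C → ℝ) (τ : ℝ) (t t' : ChoreTuple C) :
    Prop :=
  ∃ (k : ℕ) (Ak : Finset C) (ck c₀ : C) (D : List (Finset C)),
    t.bundles[k]? = some Ak ∧ IsExcessive prec v τ Ak ck ∧
    (∀ B ∈ t.bundles.take k, ¬ ∃ c, IsExcessive prec v τ B c) ∧
    IsSuitableReduced v τ t k ck c₀ D ∧
    t' = { items := replaceChore t.items ck c₀
           bundles := D.take (k + 1) ++ t.bundles.drop (k + 1) }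

/-- `ReductionRun prec v τ c t i s`: started from the tuple `t` and the unallocated chore `c`,
the algorithm can hold the tuple `s` after `i` iterations of its while loop. -/
inductive ReductionRun {C : Type*} (prec : C → C → Prop) (v : C → ℝ) (τ : ℝ) (c : C)
    (t : ChoreTuple C) : ℕ → ChoreTuple C → Prop
  | init {s : ChoreTuple C} : TidyUp prec v c t s → ReductionRun prec v τ c t 0 s
  | step {i : ℕ} {s s₁ s₂ : ChoreTuple C} : ReductionRun prec v τ c t i s →
      ReplaceStep prec v τ s s₁ → TidyUp prec v c s₁ s₂ →
      ReductionRun prec v τ c t (i + 1) s₂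

/-- `t'` is an output of the Reduction algorithm on the tuple `t` and the unallocated chore `c`. -/
def Reduction {C : Type*} (prec : C → C → Prop) (v : C → ℝ) (τ : ℝ) (c : C)
    (t t' : ChoreTuple C) : Prop :=
  ∃ i, ReductionRun prec v τ c t i t' ∧ ¬ HasExcessive prec v τ t'

/-! ### A supply of new chores -/

/-- The given chores together with an unlimited supply of new chores of every cost, from which the
reduced chores are taken. -/
inductive Chore (α : Type*) : Type _
  | orig (a : α) : Chore α
  | new (i : ℕ) (x : ℝ≥0) : Chore α

/-- The cost function `v` on the given chores, extended to the new ones. -/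
def extCost {α : Type*} (v : α → ℝ) : Chore α → ℝ
  | .orig a => v a
  | .new _ x => x

/-- A tuple on the given chores, viewed as a tuple on the larger supply of chores. -/
def ChoreTuple.lift {α : Type*} (t : ChoreTuple α) : ChoreTuple (Chore α) where
  items := t.items.image Chore.orig
  bundles := t.bundles.map (fun B => B.image Chore.orig)

end ChoreReduction

end

namespace ChoreReduction

variable {C : Type*} {v : C → ℝ} {τ μ : ℝ}

/-! ### Costs -/

/-! Lexicographic maximality is replaced by a local condition. A bundle lexicographically dominates
every affordable subset of the available chores exactly when it is `Packed`: no available chore of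
positive cost fits on top of the chores of the bundle that are at least as large (`Packed.of_lexLE`,
`Packed.lexLE`). This condition survives any shrinking of the available set. First Fit Validity thus
becomes `FirstFit`; for positive costs and bundles of cost at most `τ` this is `Greedy`, and greedy
lists are exactly the outputs of FFD for suitable tie-breaking (`Greedy.isFFDOutput`). So everything
reduces to preserving `FirstFit`, the maximin bound and the unallocated chore `c`.

Tidy-Up: averaging gives `τ < μ + v c` (`Tidying.lt_add`), so a bundle stripped of redundant chores
still has no room for anything. An exchange replaces a chore of a part by a preimage that is no more
expensive, so the parts stay cheap. A domination map can be chosen to fix the common chores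
(`Dominates.exists_fixing`), and then every order of the exchanges works.

Reduction: each replacement turns the bundles up to the first excessive one into FFD bins, so the
number of bundles above `τ` drops; this bounds the iterations by `n` (`ReductionRun.spec`).

The core is `IsTidied.exists_replaceStep`. Since `τ ≥ 8/7 μ`, every remaining chore costs more than
`τ/8`. Let `E` be the excessive bundle without its last chore and `ρ` the room it leaves. If no
available chore fits after `E`, a new chore of cost `0` works. If `ρ < 2 v c`, a copy of the largest
fitting chore works. Otherwise `E` consists of exactly two chores, and a new chore of cost `ρ` fills
the bin exactly; this bin is inserted before the first bundle with room for `ρ`. Undominated parts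
containing an allocated chore have at least three chores, so allocated chores cost at most `μ - 2 v
c`, and `le_of_room_fits` shows that the insertion is consistent with greedy filling. -/

lemma cost_nonneg (hv : ∀ c, 0 ≤ v c) (B : Finset C) : 0 ≤ cost v B :=
  Finset.sum_nonneg fun c _ => hv c

lemma cost_mono (hv : ∀ c, 0 ≤ v c) {B B' : Finset C} (h : B ⊆ B') : cost v B ≤ cost v B' :=
  Finset.sum_le_sum_of_subset_of_nonneg h fun c _ _ => hv c

lemma cost_insert {c : C} {B : Finset C} (h : c ∉ B) : cost v (insert c B) = cost v B + v c := by
  rw [cost, Finset.sum_insert h, add_comm, cost]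

lemma cost_erase {c : C} {B : Finset C} (h : c ∈ B) : cost v (B.erase c) + v c = cost v B :=
  Finset.sum_erase_add _ _ h

lemma cost_union_of_disjoint {B B' : Finset C} (h : Disjoint B B') :
    cost v (B ∪ B') = cost v B + cost v B' := Finset.sum_union h

lemma cost_union_le (hv : ∀ c, 0 ≤ v c) (B B' : Finset C) :
    cost v (B ∪ B') ≤ cost v B + cost v B' := by
  have h := Finset.sum_union_inter (s₁ := B) (s₂ := B') (f := v)
  have h' := cost_nonneg hv (B ∩ B')
  simp only [cost] at *
  linarith

/-- The chores of `B` that cost at least `w`. -/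
noncomputable def atLeast (v : C → ℝ) (B : Finset C) (w : ℝ) : Finset C := B.filter (fun x => w ≤ v x)

lemma mem_atLeast {B : Finset C} {w : ℝ} {x : C} : x ∈ atLeast v B w ↔ x ∈ B ∧ w ≤ v x :=
  Finset.mem_filter

lemma atLeast_subset (B : Finset C) (w : ℝ) : atLeast v B w ⊆ B := Finset.filter_subset _ _

lemma atLeast_eq_self {B : Finset C} {w : ℝ} (h : ∀ x ∈ B, w ≤ v x) : atLeast v B w = B :=
  Finset.filter_true_of_mem h

/-! ### The lexicographic order in terms of large chores -/

/-- In a decreasing list the entries with an upward closed property form an initial segment; `¬ Q 0`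
covers the positions past the end, where `getD` returns `0`. -/
lemma getD_iff_lt_countP {l : List ℝ} (hl : l.Pairwise (· ≥ ·)) {Q : ℝ → Prop}
    (hQ : ∀ x y, x ≤ y → Q x → Q y) (h0 : ¬ Q 0) (p : ℕ) :
    Q (l.getD p 0) ↔ p < l.countP (fun x => decide (Q x)) := by
  induction l generalizing p with
  | nil => simpa using h0
  | cons a l ih =>
    rw [List.pairwise_cons] at hl
    by_cases ha : Q a
    · cases p with
      | zero => simp [ha]
      | succ p => simp [ha, ← ih hl.2 p]
    · have hz : l.countP (fun x => decide (Q x)) = 0 := by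
        rw [List.countP_eq_zero]
        intro b hb
        simpa using fun h => ha (hQ _ _ (hl.1 b hb) h)
      cases p with
      | zero => simp [ha, hz]
      | succ p => simpa [ha, hz] using ih hl.2 p

lemma take_countP_eq_filter {l : List ℝ} (hl : l.Pairwise (· ≥ ·)) {Q : ℝ → Prop}
    (hQ : ∀ x y, x ≤ y → Q x → Q y) :
    l.take (l.countP (fun x => decide (Q x))) = l.filter (fun x => decide (Q x)) := by
  induction l with
  | nil => simp
  | cons a l ih =>
    rw [List.pairwise_cons] at hl
    by_cases ha : Q a
    · simp [ha, ih hl.2]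
    · have hz : ∀ b ∈ l, ¬ Q b := fun b hb h => ha (hQ _ _ (hl.1 b hb) h)
      have h1 : l.countP (fun x => decide (Q x)) = 0 := by
        rw [List.countP_eq_zero]; simpa using hz
      have h2 : l.filter (fun x => decide (Q x)) = [] := by
        rw [List.filter_eq_nil_iff]; simpa using hz
      simp [ha, h1, h2]

lemma sum_take_eq_sum_getD (l : List ℝ) (q : ℕ) :
    (l.take q).sum = ∑ p ∈ Finset.range q, l.getD p 0 := by
  induction l generalizing q with
  | nil => simp
  | cons a l ih =>
    cases q with
    | zero => simp
    | succ q => simp [Finset.sum_range_succ', ih q, add_comm]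

lemma pairwise_sort_costs (B : Finset C) :
    ((B.val.map v).sort (· ≥ ·)).Pairwise (· ≥ ·) := Multiset.pairwise_sort _ _

lemma countP_sort_costs (B : Finset C) (Q : ℝ → Prop) :
    ((B.val.map v).sort (· ≥ ·)).countP (fun x => decide (Q x)) =
      (B.filter (fun x => Q (v x))).card := by
  have h := Multiset.coe_countP (p := Q) ((B.val.map v).sort (· ≥ ·))
  rw [Multiset.sort_eq, Multiset.countP_map] at h
  rw [← h]
  rfl

lemma nthCost_iff {Q : ℝ → Prop} (hQ : ∀ x y, x ≤ y → Q x → Q y) (h0 : ¬ Q 0)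
    (B : Finset C) (p : ℕ) :
    Q (nthCost v B p) ↔ p < (B.filter (fun x => Q (v x))).card := by
  rw [nthCost, getD_iff_lt_countP (pairwise_sort_costs B) hQ h0, countP_sort_costs]

lemma le_nthCost_iff {w : ℝ} (hw : 0 < w) (B : Finset C) (p : ℕ) :
    w ≤ nthCost v B p ↔ p < (atLeast v B w).card :=
  nthCost_iff (Q := fun x => w ≤ x) (fun _ _ h h' => h'.trans h) (not_le.2 hw) B p

lemma lt_nthCost_iff {w : ℝ} (hw : 0 ≤ w) (B : Finset C) (p : ℕ) :
    w < nthCost v B p ↔ p < (B.filter (fun x => w < v x)).card :=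
  nthCost_iff (Q := fun x => w < x) (fun _ _ h h' => h'.trans_le h) (not_lt.2 hw) B p

lemma cost_atLeast_eq (B : Finset C) (w : ℝ) :
    cost v (atLeast v B w) = ∑ p ∈ Finset.range (atLeast v B w).card, nthCost v B p := by
  have hQ : ∀ x y : ℝ, x ≤ y → w ≤ x → w ≤ y := fun _ _ h h' => h'.trans h
  have h1 := take_countP_eq_filter (pairwise_sort_costs (v := v) B) hQ
  have h2 := countP_sort_costs (v := v) B (fun x => w ≤ x)
  rw [h2] at h1
  have h3 := sum_take_eq_sum_getD ((B.val.map v).sort (· ≥ ·)) (atLeast v B w).card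
  change _ = ∑ p ∈ Finset.range (atLeast v B w).card, nthCost v B p at h3
  rw [← h3]
  change _ = (List.take (B.filter (fun x => w ≤ v x)).card _).sum
  rw [h1, ← Multiset.sum_coe, ← Multiset.filter_coe, Multiset.sort_eq, Multiset.filter_map]
  rfl

lemma nthCost_nonneg (hv : ∀ c, 0 ≤ v c) (B : Finset C) (p : ℕ) : 0 ≤ nthCost v B p := by
  rw [nthCost, List.getD_eq_getElem?_getD]
  rcases h : ((B.val.map v).sort (· ≥ ·))[p]? with _ | a
  · simp
  · have := List.mem_of_getElem? h
    rw [Multiset.mem_sort, Multiset.mem_map] at this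
    obtain ⟨c, -, rfl⟩ := this
    simpa using hv c

lemma sum_nthCost_le_cost (hv : ∀ c, 0 ≤ v c) (B : Finset C) (q : ℕ) :
    ∑ p ∈ Finset.range q, nthCost v B p ≤ cost v B := by
  have h := sum_take_eq_sum_getD ((B.val.map v).sort (· ≥ ·)) q
  have h1 : (((B.val.map v).sort (· ≥ ·)).take q).sum ≤ ((B.val.map v).sort (· ≥ ·)).sum := by
    apply (List.take_sublist _ _).sum_le_sum
    intro a ha
    rw [Multiset.mem_sort, Multiset.mem_map] at ha
    obtain ⟨c, -, rfl⟩ := ha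
    exact hv c
  rw [← Multiset.sum_coe ((B.val.map v).sort (· ≥ ·)), Multiset.sort_eq, h] at h1
  exact h1

lemma lexLE_or_lt (B B' : Finset C) : LexLE v B B' ∨
    ∃ q, (∀ p < q, nthCost v B' p = nthCost v B p) ∧ nthCost v B' q < nthCost v B q := by
  by_cases h : LexEq v B B'
  · exact Or.inl (Or.inl h)
  · simp only [LexEq, not_forall] at h
    have h1 := Nat.find_spec h
    have h2 : ∀ p < Nat.find h, nthCost v B p = nthCost v B' p := fun p hp => by
      simpa using Nat.find_min h hp
    rcases lt_or_gt_of_ne h1 with h1 | h1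
    · exact Or.inl (Or.inr ⟨_, h2, h1⟩)
    · exact Or.inr ⟨_, fun p hp => (h2 p hp).symm, h1⟩

/-- No chore of `S` of positive cost can be added to the chores of `B` that are at least as
large. -/
def Packed (v : C → ℝ) (τ : ℝ) (B S : Finset C) : Prop :=
  ∀ c ∈ S, c ∉ B → 0 < v c → τ < cost v (atLeast v B (v c)) + v c

lemma Packed.mono {B S S' : Finset C} (h : Packed v τ B S) (hS : S' ⊆ S) : Packed v τ B S' :=
  fun c hc => h c (hS hc)

/-- If `c` did fit, then `c` with the chores of `B` that are at least as large would be an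
affordable set that agrees with `B` on the first `q` positions and beats it at position `q`. No
bound on the cost of `B` itself is needed, so this applies to excessive bundles. -/
lemma Packed.of_lexLE (hv : ∀ c, 0 ≤ v c) {B S : Finset C} (hB : B ⊆ S)
    (h : ∀ B', B' ⊆ S → cost v B' ≤ τ → LexLE v B' B) : Packed v τ B S := by
  intro c hc hcB hpos
  by_contra! hle
  set B' := insert c (atLeast v B (v c)) with hB'
  have hcat : c ∉ atLeast v B (v c) := fun h => hcB (atLeast_subset _ _ h)
  have hlex := h B' (Finset.insert_subset hc ((atLeast_subset _ _).trans hB))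
    (by rwa [hB', cost_insert hcat])
  set q := (atLeast v B (v c)).card with hq
  have hq' : ∀ w, w ≤ v c → atLeast v B' w = B' := fun w hw => atLeast_eq_self fun x hx => by
    rcases Finset.mem_insert.1 hx with rfl | hx
    · exact hw
    · exact hw.trans (mem_atLeast.1 hx).2
  have hcard : B'.card = q + 1 := Finset.card_insert_of_notMem hcat
  have hgt : ∀ w, v c < w → atLeast v B' w = atLeast v B w := by
    intro w hw
    ext x
    simp only [mem_atLeast, hB', Finset.mem_insert]
    constructor
    · rintro ⟨rfl | hx, h⟩
      · exact absurd h (not_le.2 hw)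
      · exact ⟨hx.1, h⟩
    · rintro ⟨hx, h⟩
      exact ⟨Or.inr ⟨hx, hw.le.trans h⟩, h⟩
  -- Costs at a position are compared through counts of chores above a threshold: for `w ≤ v c` both
  -- counts are at least `q`, for `w > v c` the two sets coincide.
  have key : ∀ w, 0 < w → ∀ p < q, w ≤ nthCost v B' p ↔ w ≤ nthCost v B p := by
    intro w hw p hp
    rw [le_nthCost_iff hw, le_nthCost_iff hw]
    rcases le_or_gt w (v c) with h1 | h1
    · rw [hq' w h1, hcard]
      have : q ≤ (atLeast v B w).card := Finset.card_le_card fun x hx =>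
        mem_atLeast.2 ⟨(mem_atLeast.1 hx).1, h1.trans (mem_atLeast.1 hx).2⟩
      omega
    · rw [hgt w h1]
  have heq : ∀ p < q, nthCost v B' p = nthCost v B p := by
    intro p hp
    apply le_antisymm
    · rcases (nthCost_nonneg hv B' p).eq_or_lt with h0 | h0
      · rw [← h0]; exact nthCost_nonneg hv B p
      · exact (key _ h0 p hp).1 le_rfl
    · rcases (nthCost_nonneg hv B p).eq_or_lt with h0 | h0
      · rw [← h0]; exact nthCost_nonneg hv B' p
      · exact (key _ h0 p hp).2 le_rfl
  have h1 : v c ≤ nthCost v B' q := by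
    rw [le_nthCost_iff hpos, hq' _ le_rfl, hcard]; omega
  have h2 : nthCost v B q < v c := by
    rw [← not_le, le_nthCost_iff hpos]; omega
  rcases hlex with hlex | ⟨q', hlt, hlex⟩
  · linarith [hlex q]
  · rcases lt_trichotomy q' q with h3 | rfl | h3
    · exact absurd (heq q' h3) hlex.ne
    · linarith
    · linarith [hlt q h3]

/-- At the first position `q` where `B` beats `A`, let `w` be the cost in `B`. Some chore of `B` of
cost `w` is missing from `A` and does not fit on the chores of `A` of cost at least `w`; but these
are matched by the first `q` entries of `B`, so `B` would cost more than `τ`. -/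
lemma Packed.lexLE (hv : ∀ c, 0 ≤ v c) {A S : Finset C} (h : Packed v τ A S)
    {B : Finset C} (hBS : B ⊆ S) (hB : cost v B ≤ τ) : LexLE v B A := by
  rcases lexLE_or_lt (v := v) B A with h1 | ⟨q, hlt, hq⟩
  · exact h1
  exfalso
  set w := nthCost v B q with hw
  have hw0 : 0 < w := (nthCost_nonneg hv A q).trans_lt hq
  have hA : (atLeast v A w).card ≤ q := by
    rw [← not_lt, ← le_nthCost_iff hw0]; exact not_le.2 hq
  have hBc : q < (atLeast v B w).card := by
    rw [← le_nthCost_iff hw0]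
  -- Both counts are at most `q` and the first `q` entries agree, so neither count can exceed the
  -- other.
  have hgt : (A.filter (fun x => w < v x)).card = (B.filter (fun x => w < v x)).card := by
    have h1 : (A.filter (fun x => w < v x)).card ≤ q := by
      rw [← not_lt, ← lt_nthCost_iff hw0.le]; exact not_lt.2 hq.le
    have h2 : (B.filter (fun x => w < v x)).card ≤ q := by
      rw [← not_lt, ← lt_nthCost_iff hw0.le]; exact lt_irrefl _
    by_contra hne
    rcases lt_or_gt_of_ne hne with h3 | h3
    · have h4 := (lt_nthCost_iff hw0.le _ _).2 h3
      rw [← hlt _ (h3.trans_le h2), lt_nthCost_iff hw0.le] at h4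
      exact lt_irrefl _ h4
    · have h4 := (lt_nthCost_iff hw0.le _ _).2 h3
      rw [hlt _ (h3.trans_le h1), lt_nthCost_iff hw0.le] at h4
      exact lt_irrefl _ h4
  have hsplit : ∀ D : Finset C, (atLeast v D w).card =
      (D.filter (fun x => w < v x)).card + (D.filter (fun x => v x = w)).card := by
    intro D
    rw [← Finset.card_union_of_disjoint]
    · congr 1
      ext x
      simp only [mem_atLeast, Finset.mem_union, Finset.mem_filter, le_iff_lt_or_eq, eq_comm (a := w)]
      tauto
    · rw [Finset.disjoint_filter]
      intro x _ h1 h2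
      exact h1.ne' h2
  -- `B` has more than `q` chores of cost at least `w` and `A` at most `q`, while equally many
  -- exceed `w`: hence `B` has more chores of cost exactly `w`.
  have hex : ∃ c ∈ B.filter (fun x => v x = w), c ∉ A.filter (fun x => v x = w) := by
    by_contra! hcon
    have := Finset.card_le_card (show B.filter (fun x => v x = w) ⊆ _ from hcon)
    have h1 := hsplit A
    have h2 := hsplit B
    omega
  obtain ⟨c, hcB, hcA⟩ := hex
  rw [Finset.mem_filter] at hcB
  have hcA : c ∉ A := fun h => hcA (Finset.mem_filter.2 ⟨h, hcB.2⟩)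
  have h1 := h c (hBS hcB.1) hcA (hcB.2 ▸ hw0)
  rw [hcB.2, cost_atLeast_eq] at h1
  have h2 : ∑ p ∈ Finset.range (atLeast v A w).card, nthCost v A p ≤
      ∑ p ∈ Finset.range q, nthCost v B p := by
    calc _ = ∑ p ∈ Finset.range (atLeast v A w).card, nthCost v B p :=
          Finset.sum_congr rfl fun p hp => hlt p ((Finset.mem_range.1 hp).trans_le hA)
      _ ≤ _ := Finset.sum_le_sum_of_subset_of_nonneg (Finset.range_mono hA)
          fun p _ _ => nthCost_nonneg hv B p
  have h3 := sum_nthCost_le_cost hv B (q + 1)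
  rw [Finset.sum_range_succ, ← hw] at h3
  linarith

/-! ### Allocated chores -/

@[simp] lemma allocated_nil : allocated ([] : List (Finset C)) = ∅ := rfl

@[simp] lemma allocated_cons (B : Finset C) (l : List (Finset C)) :
    allocated (B :: l) = B ∪ allocated l := rfl

lemma mem_allocated {A : List (Finset C)} {x : C} : x ∈ allocated A ↔ ∃ B ∈ A, x ∈ B := by
  induction A with
  | nil => simp
  | cons B l ih => simp [ih]

lemma allocated_append (l l' : List (Finset C)) :
    allocated (l ++ l') = allocated l ∪ allocated l' := by
  ext x; simp only [mem_allocated, Finset.mem_union, List.mem_append]; aesop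

lemma cost_allocated {A : List (Finset C)} (h : A.Pairwise Disjoint) :
    cost v (allocated A) = (A.map (cost v)).sum := by
  induction A with
  | nil => simp [cost]
  | cons B l ih =>
    rw [List.pairwise_cons] at h
    rw [allocated_cons, cost_union_of_disjoint, ih h.2, List.map_cons, List.sum_cons]
    rw [Finset.disjoint_left]
    intro x hx hx'
    obtain ⟨B', hB', hx'⟩ := mem_allocated.1 hx'
    exact Finset.disjoint_left.1 (h.1 B' hB') hx hx'

lemma eq_of_mem_of_mem {A : List (Finset C)} (h : A.Pairwise Disjoint) {B B' : Finset C}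
    (hB : B ∈ A) (hB' : B' ∈ A) {x : C} (hx : x ∈ B) (hx' : x ∈ B') : B = B' := by
  by_contra hne
  exact Finset.disjoint_left.1 (h.forall hB hB' hne) hx hx'

/-! ### First fit lists and greedy lists -/

/-- Every bundle is packed with respect to the chores that the earlier bundles leave. -/
def FirstFit (v : C → ℝ) (τ : ℝ) : List (Finset C) → Finset C → Prop
  | [], _ => True
  | B :: l, S => Packed v τ B S ∧ FirstFit v τ l (S \ B)

/-- Every bundle is filled greedily from the chores that the earlier bundles leave. -/
def Greedy (v : C → ℝ) (τ : ℝ) : List (Finset C) → Finset C → Prop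
  | [], _ => True
  | B :: l, S => (B ⊆ S ∧ cost v B ≤ τ ∧
      ∀ c ∈ S, c ∉ B → τ < cost v (atLeast v B (v c)) + v c) ∧ Greedy v τ l (S \ B)

lemma FirstFit.mono {l : List (Finset C)} {S S' : Finset C} (h : FirstFit v τ l S)
    (hS : S' ⊆ S) : FirstFit v τ l S' := by
  induction l generalizing S S' with
  | nil => trivial
  | cons B l ih => exact ⟨h.1.mono hS, ih h.2 (Finset.sdiff_subset_sdiff hS le_rfl)⟩

lemma Greedy.subset {l : List (Finset C)} {S : Finset C} (h : Greedy v τ l S) :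
    ∀ B ∈ l, B ⊆ S := by
  induction l generalizing S with
  | nil => simp
  | cons B l ih =>
    intro B' hB'
    rcases List.mem_cons.1 hB' with rfl | hB'
    · exact h.1.1
    · exact (ih h.2 B' hB').trans Finset.sdiff_subset

lemma Greedy.cost_le {l : List (Finset C)} {S : Finset C} (h : Greedy v τ l S) :
    ∀ B ∈ l, cost v B ≤ τ := by
  induction l generalizing S with
  | nil => simp
  | cons B l ih =>
    intro B' hB'
    rcases List.mem_cons.1 hB' with rfl | hB'
    · exact h.1.2.1
    · exact ih h.2 B' hB'

lemma Greedy.pairwise {l : List (Finset C)} {S : Finset C} (h : Greedy v τ l S) :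
    l.Pairwise Disjoint := by
  induction l generalizing S with
  | nil => simp
  | cons B l ih =>
    exact List.pairwise_cons.2 ⟨fun B' hB' =>
      (Finset.sdiff_disjoint.mono_left (h.2.subset B' hB')).symm, ih h.2⟩

lemma Greedy.mono {l : List (Finset C)} {S S' : Finset C} (h : Greedy v τ l S)
    (hS : S' ⊆ S) (hl : ∀ B ∈ l, B ⊆ S') : Greedy v τ l S' := by
  induction l generalizing S S' with
  | nil => trivial
  | cons B l ih =>
    refine ⟨⟨hl B (by simp), h.1.2.1, fun c hc => h.1.2.2 c (hS hc)⟩,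
      ih h.2 (Finset.sdiff_subset_sdiff hS le_rfl) fun B' hB' x hx => ?_⟩
    exact Finset.mem_sdiff.2 ⟨hl B' (by simp [hB']) hx,
      (Finset.mem_sdiff.1 (h.2.subset B' hB' hx)).2⟩

lemma Greedy.firstFit {l : List (Finset C)} {S : Finset C} (h : Greedy v τ l S) :
    FirstFit v τ l S := by
  induction l generalizing S with
  | nil => trivial
  | cons B l ih => exact ⟨fun c hc hcB _ => h.1.2.2 c hc hcB, ih h.2⟩

/-- The lexicographic order does not see chores of cost `0`, so `Packed` ignores them while FFD does
not. Positivity removes the difference. -/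
lemma FirstFit.greedy {l : List (Finset C)} {S : Finset C} (h : FirstFit v τ l S)
    (hS : ∀ x ∈ S, 0 < v x) (hl : ∀ B ∈ l, B ⊆ S) (hd : l.Pairwise Disjoint)
    (hτ : ∀ B ∈ l, cost v B ≤ τ) : Greedy v τ l S := by
  induction l generalizing S with
  | nil => trivial
  | cons B l ih =>
    rw [List.pairwise_cons] at hd
    refine ⟨⟨hl B (by simp), hτ B (by simp), fun c hc hcB => h.1 c hc hcB (hS c hc)⟩,
      ih h.2 (fun x hx => hS x (Finset.mem_sdiff.1 hx).1) (fun B' hB' x hx => ?_) hd.2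
      fun B' hB' => hτ B' (by simp [hB'])⟩
    exact Finset.mem_sdiff.2 ⟨hl B' (by simp [hB']) hx,
      fun hx' => Finset.disjoint_left.1 (hd.1 B' hB') hx' hx⟩

lemma firstFit_append {l l' : List (Finset C)} {S : Finset C} :
    FirstFit v τ (l ++ l') S ↔ FirstFit v τ l S ∧ FirstFit v τ l' (S \ allocated l) := by
  induction l generalizing S with
  | nil => simp [FirstFit]
  | cons B l ih => simp [FirstFit, ih, sdiff_sdiff, and_assoc]

lemma greedy_append {l l' : List (Finset C)} {S : Finset C} :
    Greedy v τ (l ++ l') S ↔ Greedy v τ l S ∧ Greedy v τ l' (S \ allocated l) := by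
  induction l generalizing S with
  | nil => simp [Greedy]
  | cons B l ih => simp [Greedy, ih, sdiff_sdiff, and_assoc]

/-- Earlier bundles see fewer chores than before, later ones exactly the same. -/
lemma FirstFit.eraseIdx {l : List (Finset C)} {S : Finset C} (h : FirstFit v τ l S) {k : ℕ}
    {B : Finset C} (hk : l[k]? = some B) : FirstFit v τ (l.eraseIdx k) (S \ B) := by
  induction l generalizing S k with
  | nil => trivial
  | cons B' l ih =>
    cases k with
    | zero =>
      simp only [List.getElem?_cons_zero, Option.some.injEq] at hk
      subst hk
      exact h.2
    | succ k =>
      refine ⟨h.1.mono Finset.sdiff_subset, ?_⟩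
      have := ih h.2 (k := k) (by simpa using hk)
      rwa [sdiff_right_comm] at this

lemma firstFit_iff {l : List (Finset C)} {S : Finset C} : FirstFit v τ l S ↔
    ∀ k B, l[k]? = some B → Packed v τ B (S \ allocated (l.take k)) := by
  induction l generalizing S with
  | nil => simp [FirstFit]
  | cons B l ih =>
    rw [FirstFit, ih]
    constructor
    · rintro ⟨h1, h2⟩ (_ | k) B' hB'
      · simp only [List.getElem?_cons_zero, Option.some.injEq] at hB'
        subst hB'
        simpa using h1
      · have := h2 k B' (by simpa using hB')
        rwa [sdiff_sdiff] at this
    · intro h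
      refine ⟨by simpa using h 0 B (by simp), fun k B' hB' => ?_⟩
      have := h (k + 1) B' (by simpa using hB')
      rwa [List.take_succ_cons, allocated_cons, ← Finset.sup_eq_union, ← sdiff_sdiff] at this

/-! ### First Fit Decreasing is greedy -/

/-- The witness `T` is the content of the bin at the moment when `c` is rejected; it consists of
chores listed earlier, hence at least as large. -/
lemma ffdBin_aux {l : List C} {acc : Finset C} (hl : l.Pairwise (fun a b => v b ≤ v a))
    (hacc : ∀ a ∈ acc, ∀ b ∈ l, v b ≤ v a) (hτ : cost v acc ≤ τ) :
    let D := l.foldl (fun B c => if cost v (insert c B) ≤ τ then insert c B else B) acc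
    acc ⊆ D ∧ D ⊆ acc ∪ l.toFinset ∧ cost v D ≤ τ ∧
      ∀ c ∈ l, c ∉ D → ∃ T ⊆ D, (∀ a ∈ T, v c ≤ v a) ∧ τ < cost v (insert c T) := by
  induction l generalizing acc with
  | nil => simpa using hτ
  | cons x l ih =>
    rw [List.pairwise_cons] at hl
    simp only [List.foldl_cons]
    by_cases hx : cost v (insert x acc) ≤ τ
    · simp only [hx, if_true]
      obtain ⟨h1, h2, h3, h4⟩ := ih (acc := insert x acc) hl.2 (by
        intro a ha b hb
        rcases Finset.mem_insert.1 ha with rfl | ha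
        · exact hl.1 b hb
        · exact hacc a ha b (by simp [hb])) hx
      refine ⟨(Finset.subset_insert _ _).trans h1, h2.trans ?_, h3, ?_⟩
      · intro y hy
        simp only [Finset.mem_union, Finset.mem_insert, List.mem_toFinset, List.mem_cons] at hy ⊢
        tauto
      · intro c hc hcD
        rcases List.mem_cons.1 hc with rfl | hc
        · exact absurd (h1 (Finset.mem_insert_self _ _)) hcD
        · exact h4 c hc hcD
    · simp only [hx, if_false]
      obtain ⟨h1, h2, h3, h4⟩ := ih (acc := acc) hl.2
        (fun a ha b hb => hacc a ha b (by simp [hb])) hτ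
      refine ⟨h1, h2.trans ?_, h3, ?_⟩
      · intro y hy
        simp only [Finset.mem_union, List.mem_toFinset, List.mem_cons] at hy ⊢
        tauto
      · intro c hc hcD
        rcases List.mem_cons.1 hc with rfl | hc
        · exact ⟨acc, h1, fun a ha => hacc a ha c (by simp), not_le.1 hx⟩
        · exact h4 c hc hcD

lemma ffdBin_greedy (hv : ∀ c, 0 ≤ v c) (hτ : 0 ≤ τ) {l : List C}
    (hl : l.Pairwise (fun a b => v b ≤ v a)) :
    ffdBin v τ l ⊆ l.toFinset ∧ cost v (ffdBin v τ l) ≤ τ ∧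
      ∀ c ∈ l.toFinset, c ∉ ffdBin v τ l →
        τ < cost v (atLeast v (ffdBin v τ l) (v c)) + v c := by
  obtain ⟨-, h2, h3, h4⟩ := ffdBin_aux (acc := ∅) hl (by simp) (by simpa [cost] using hτ)
  refine ⟨by rwa [Finset.empty_union] at h2, h3, fun c hc hcD => ?_⟩
  obtain ⟨T, hT, hTc, hlt⟩ := h4 c (by simpa using hc) hcD
  rw [cost_insert fun h => hcD (hT h)] at hlt
  have : cost v T ≤ cost v (atLeast v (ffdBin v τ l) (v c)) :=
    cost_mono hv fun a ha => mem_atLeast.2 ⟨hT ha, hTc a ha⟩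
  linarith

lemma ffd_greedy (hv : ∀ c, 0 ≤ v c) (hτ : 0 ≤ τ) {l : List C}
    (hl : l.Pairwise (fun a b => v b ≤ v a)) (n : ℕ) : Greedy v τ (ffd v τ l n) l.toFinset := by
  induction n generalizing l with
  | zero => trivial
  | succ n ih =>
    refine ⟨ffdBin_greedy hv hτ hl, ?_⟩
    have := ih (l := l.filter (fun c => c ∉ ffdBin v τ l)) (hl.filter _)
    convert this using 1
    ext x; simp

@[simp] lemma length_ffd (l : List C) (n : ℕ) : (ffd v τ l n).length = n := by
  induction n generalizing l with
  | zero => rfl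
  | succ n ih => simp [ffd, ih]

lemma IsFFDOutput.greedy (hv : ∀ c, 0 ≤ v c) (hτ : 0 ≤ τ) {M : Finset C} {n : ℕ}
    {D : List (Finset C)} (h : IsFFDOutput v M τ n D) : Greedy v τ D M := by
  obtain ⟨l, -, rfl, hl, rfl⟩ := h
  exact ffd_greedy hv hτ hl n

lemma IsFFDOutput.length_eq {M : Finset C} {n : ℕ} {D : List (Finset C)}
    (h : IsFFDOutput v M τ n D) : D.length = n := by
  obtain ⟨l, -, -, -, rfl⟩ := h
  simp

lemma exists_list_pairwise (r : C → C → Prop) [Std.Total r] [IsTrans C r] (S : Finset C) :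
    ∃ l : List C, l.Nodup ∧ l.toFinset = S ∧ l.Pairwise r := by
  have hp := List.perm_insertionSort r S.toList
  refine ⟨S.toList.insertionSort r, hp.nodup_iff.2 S.nodup_toList, ?_,
    List.pairwise_insertionSort _ _⟩
  ext x
  simp [hp.mem_iff]

lemma exists_greedy (hv : ∀ c, 0 ≤ v c) (hτ : 0 ≤ τ) (S : Finset C) (n : ℕ) :
    ∃ D : List (Finset C), D.length = n ∧ Greedy v τ D S := by
  have : Std.Total (fun a b : C => v b ≤ v a) := ⟨fun a b => le_total _ _⟩
  have : IsTrans C (fun a b : C => v b ≤ v a) := ⟨fun a b c h h' => h'.trans h⟩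
  obtain ⟨l, -, rfl, hl⟩ := exists_list_pairwise (fun a b : C => v b ≤ v a) S
  exact ⟨_, length_ffd l n, ffd_greedy hv hτ hl n⟩

/-! ### Greedy lists are outputs of First Fit Decreasing -/

/-- Invariant of the filling: after the chores `l₁` the bin is `B ∩ l₁`. A chore of `B` always fits
because `B` costs at most `τ`; the hypothesis rejects every other chore. -/
lemma foldl_eq_filter (hv : ∀ c, 0 ≤ v c) {B : Finset C} (hB : cost v B ≤ τ) (l₂ l₁ : List C)
    (h : ∀ s c s', l₂ = s ++ c :: s' → c ∉ B → c ∉ l₁ ∧ c ∉ s ∧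
      τ < cost v (B.filter (fun x => x ∈ l₁ ∨ x ∈ s)) + v c) :
    l₂.foldl (fun B c => if cost v (insert c B) ≤ τ then insert c B else B)
      (B.filter (fun x => x ∈ l₁)) = B.filter (fun x => x ∈ l₁ ∨ x ∈ l₂) := by
  induction l₂ generalizing l₁ with
  | nil => simp
  | cons c l₂ ih =>
    have hstep : (if cost v (insert c (B.filter (fun x => x ∈ l₁))) ≤ τ then
        insert c (B.filter (fun x => x ∈ l₁)) else B.filter (fun x => x ∈ l₁)) =
        B.filter (fun x => x ∈ c :: l₁) := by
      by_cases hc : c ∈ B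
      · have : insert c (B.filter (fun x => x ∈ l₁)) = B.filter (fun x => x ∈ c :: l₁) := by
          ext x
          simp only [Finset.mem_insert, Finset.mem_filter, List.mem_cons]
          constructor
          · rintro (rfl | h)
            · exact ⟨hc, Or.inl rfl⟩
            · exact ⟨h.1, Or.inr h.2⟩
          · rintro ⟨h, rfl | h'⟩
            · exact Or.inl rfl
            · exact Or.inr ⟨h, h'⟩
        rw [this, if_pos ((cost_mono hv (Finset.filter_subset _ _)).trans hB)]
      · obtain ⟨h1, -, h2⟩ := h [] c l₂ rfl hc
        rw [cost_insert (by simp [hc]), if_neg (by simpa using h2)]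
        ext x
        simp only [Finset.mem_filter, List.mem_cons]
        constructor
        · exact fun h => ⟨h.1, Or.inr h.2⟩
        · rintro ⟨hx, rfl | h'⟩
          · exact absurd hx hc
          · exact ⟨hx, h'⟩
    rw [List.foldl_cons, hstep, ih]
    · ext x; simp; tauto
    · rintro s d s' rfl hd
      obtain ⟨h1, h2, h3⟩ := h (c :: s) d s' rfl hd
      simp only [List.mem_cons, not_or] at h2 ⊢
      refine ⟨⟨h2.1, h1⟩, h2.2, ?_⟩
      convert h3 using 4 with x
      simp only [List.mem_cons]
      tauto

lemma ffdBin_eq (hv : ∀ c, 0 ≤ v c) {B : Finset C} (hB : cost v B ≤ τ) {l : List C}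
    (hl : l.Nodup) (hBl : B ⊆ l.toFinset)
    (hsort : l.Pairwise (fun a b => v b ≤ v a ∧ (v a = v b → b ∈ B → a ∈ B)))
    (h : ∀ c ∈ l.toFinset, c ∉ B → τ < cost v (atLeast v B (v c)) + v c) :
    ffdBin v τ l = B := by
  have := foldl_eq_filter hv hB l [] (by
    rintro s c s' rfl hc
    rw [List.nodup_append, List.nodup_cons] at hl
    rw [List.pairwise_append, List.pairwise_cons] at hsort
    refine ⟨by simp, fun hcs => hl.2.2 c hcs c (by simp) rfl, ?_⟩
    refine (h c (by simp) hc).trans_le ?_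
    gcongr
    refine cost_mono hv fun x hx => ?_
    rw [mem_atLeast] at hx
    refine Finset.mem_filter.2 ⟨hx.1, Or.inr ?_⟩
    have hxl : x ∈ s ++ c :: s' := List.mem_toFinset.1 (hBl hx.1)
    rw [List.mem_append, List.mem_cons] at hxl
    rcases hxl with hxs | rfl | hxs
    · exact hxs
    · exact absurd hx.1 hc
    · have h1 := hsort.2.1.1 x hxs
      exact absurd (h1.2 (le_antisymm hx.2 h1.1) hx.1) hc)
  rw [ffdBin]
  simp only [List.not_mem_nil, Finset.filter_false, false_or] at this
  rw [this]
  exact Finset.filter_true_of_mem fun x hx => by simpa using hBl hx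

/-- Among chores of equal cost, those of earlier bundles come first. Chores in no bundle have
`findIdx` equal to the length of `D` and so come last. -/
lemma ffd_eq (hv : ∀ c, 0 ≤ v c) {D : List (Finset C)} {l : List C} (hl : l.Nodup)
    (hsort : l.Pairwise (fun a b => v b ≤ v a ∧
      (v a = v b → D.findIdx (fun B => decide (a ∈ B)) ≤ D.findIdx (fun B => decide (b ∈ B)))))
    (h : Greedy v τ D l.toFinset) : ffd v τ l D.length = D := by
  induction D generalizing l with
  | nil => rfl
  | cons B D ih =>
    have hbin : ffdBin v τ l = B := by
      refine ffdBin_eq hv h.1.2.1 hl h.1.1 (hsort.imp fun {a b} hab => ⟨hab.1, fun he hb => ?_⟩)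
        h.1.2.2
      have := hab.2 he
      by_contra ha
      simp [List.findIdx_cons, ha, hb] at this
    rw [List.length_cons, ffd, hbin]
    congr 1
    apply ih
    · exact hl.filter _
    · rw [List.pairwise_filter]
      refine hsort.imp fun {a b} hab ha hb => ⟨hab.1, fun he => ?_⟩
      have := hab.2 he
      simp only [decide_eq_true_eq] at ha hb
      simpa [List.findIdx_cons, ha, hb] using this
    · convert h.2 using 1
      ext x; simp

lemma Greedy.isFFDOutput (hv : ∀ c, 0 ≤ v c) {D : List (Finset C)} {S : Finset C}
    (h : Greedy v τ D S) : IsFFDOutput v S τ D.length D := by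
  let r : C → C → Prop := fun a b => v b ≤ v a ∧
    (v a = v b → D.findIdx (fun B => decide (a ∈ B)) ≤ D.findIdx (fun B => decide (b ∈ B)))
  have : Std.Total r := ⟨fun a b => by
    rcases lt_trichotomy (v a) (v b) with h | h | h
    · exact Or.inr ⟨h.le, fun h' => absurd h' h.ne'⟩
    · rcases le_total (D.findIdx (fun B => decide (a ∈ B)))
        (D.findIdx (fun B => decide (b ∈ B))) with h' | h'
      · exact Or.inl ⟨h.ge, fun _ => h'⟩
      · exact Or.inr ⟨h.le, fun _ => h'⟩
    · exact Or.inl ⟨h.le, fun h' => absurd h' h.ne'⟩⟩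
  have : IsTrans C r := ⟨fun a b c hab hbc => ⟨hbc.1.trans hab.1, fun h => by
    have h1 : v a = v b := le_antisymm (h.trans_le hbc.1) hab.1
    exact (hab.2 h1).trans (hbc.2 (h1.symm.trans h))⟩⟩
  obtain ⟨l, hnd, rfl, hl⟩ := exists_list_pairwise r S
  exact ⟨l, hnd, rfl, hl.imp fun h => h.1, (ffd_eq hv hnd hl h).symm⟩

/-! ### First Fit Valid tuples -/

lemma maxCost_nonneg (A : List (Finset C)) : 0 ≤ maxCost v A := by
  induction A with
  | nil => simp [maxCost]
  | cons B l ih => exact ih.trans (le_max_right _ _)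

lemma maxCost_le_iff (A : List (Finset C)) {x : ℝ} (hx : 0 ≤ x) :
    maxCost v A ≤ x ↔ ∀ B ∈ A, cost v B ≤ x := by
  induction A with
  | nil => simpa [maxCost] using hx
  | cons B l ih =>
    have : maxCost v (B :: l) = max (cost v B) (maxCost v l) := rfl
    simp [this, ih]

lemma mms_nonneg (v : C → ℝ) (M : Finset C) (n : ℕ) : 0 ≤ mms v M n := by
  apply Real.sInf_nonneg
  rintro x ⟨P, -, -, rfl⟩
  exact maxCost_nonneg P

lemma mms_le {M : Finset C} {P : List (Finset C)} (hP : IsComplete M P) {x : ℝ} (hx : 0 ≤ x)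
    (h : ∀ Q ∈ P, cost v Q ≤ x) : mms v M P.length ≤ x := by
  refine le_trans (csInf_le ⟨0, ?_⟩ ⟨P, rfl, hP, rfl⟩) ((maxCost_le_iff P hx).2 h)
  rintro y ⟨P, -, -, rfl⟩
  exact maxCost_nonneg P

lemma maxCost_mem (A : List (Finset C)) : maxCost v A = 0 ∨ ∃ B ∈ A, maxCost v A = cost v B := by
  induction A with
  | nil => exact Or.inl rfl
  | cons B l ih =>
    have h : maxCost v (B :: l) = max (cost v B) (maxCost v l) := rfl
    rcases max_choice (cost v B) (maxCost v l) with h' | h'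
    · exact Or.inr ⟨B, by simp, h.trans h'⟩
    · rcases ih with ih | ⟨B', hB', ih⟩
      · exact Or.inl (h.trans (h'.trans ih))
      · exact Or.inr ⟨B', by simp [hB'], h.trans (h'.trans ih)⟩

lemma exists_partition (v : C → ℝ) (M : Finset C) {n : ℕ} (hn : 1 ≤ n) :
    ∃ P : List (Finset C), P.length = n ∧ IsComplete M P ∧ ∀ Q ∈ P, cost v Q ≤ mms v M n := by
  -- Every value is `0` or the cost of a subset of `M`, so the infimum is over a finite set and is
  -- attained.
  have hfin : {x : ℝ | ∃ P : List (Finset C), P.length = n ∧ IsComplete M P ∧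
      x = maxCost v P}.Finite := by
    apply ((M.powerset.image (cost v) ∪ {0} : Finset ℝ).finite_toSet).subset
    rintro x ⟨P, -, hP, rfl⟩
    rcases maxCost_mem (v := v) P with h | ⟨B, hB, h⟩
    · simp [h]
    · rw [h]
      simp only [Finset.coe_union, Finset.coe_image, Set.mem_union, Set.mem_image]
      exact Or.inl ⟨B, by simpa using hP.subset B hB, rfl⟩
  have hne : {x : ℝ | ∃ P : List (Finset C), P.length = n ∧ IsComplete M P ∧
      x = maxCost v P}.Nonempty := by
    suffices h : IsComplete M (M :: List.replicate (n - 1) ∅) from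
      ⟨_, _, by simp; omega, h, rfl⟩
    refine { subset := ?_, disjoint := ?_, covers := ?_ }
    · intro B hB
      rcases List.mem_cons.1 hB with rfl | hB
      · exact le_rfl
      · simp [List.eq_of_mem_replicate hB]
    · refine List.pairwise_cons.2 ⟨fun B hB => ?_, ?_⟩
      · simp [List.eq_of_mem_replicate hB]
      · exact List.pairwise_replicate.2 (by simp)
    · ext x
      simp only [mem_allocated, List.mem_cons, List.mem_replicate]
      constructor
      · rintro ⟨B, rfl | ⟨-, rfl⟩, hx⟩
        · exact hx
        · simp at hx
      · exact fun hx => ⟨M, Or.inl rfl, hx⟩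
  obtain ⟨P, h1, h2, h3⟩ := hne.csInf_mem hfin
  exact ⟨P, h1, h2, (maxCost_le_iff P (mms_nonneg v M n)).1 h3.ge⟩

lemma LexLE.trans {B₁ B₂ B₃ : Finset C} (h : LexLE v B₁ B₂) (h' : LexLE v B₂ B₃) :
    LexLE v B₁ B₃ := by
  rcases h with h | ⟨q, h1, h2⟩
  · rcases h' with h' | ⟨q', h1', h2'⟩
    · exact Or.inl fun p => (h p).trans (h' p)
    · exact Or.inr ⟨q', fun p hp => (h p).trans (h1' p hp), (h q').trans_lt h2'⟩
  · rcases h' with h' | ⟨q', h1', h2'⟩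
    · exact Or.inr ⟨q, fun p hp => (h1 p hp).trans (h' p), h2.trans_eq (h' q)⟩
    · rcases lt_trichotomy q q' with h3 | rfl | h3
      · exact Or.inr ⟨q, fun p hp => (h1 p hp).trans (h1' p (hp.trans h3)),
          h2.trans_eq (h1' q h3)⟩
      · exact Or.inr ⟨q, fun p hp => (h1 p hp).trans (h1' p hp), h2.trans h2'⟩
      · exact Or.inr ⟨q', fun p hp => (h1 p (hp.trans h3)).trans (h1' p hp),
          (h1 q' h3).trans_lt h2'⟩

lemma take_disjoint_of_getElem? {A : List (Finset C)} (h : A.Pairwise Disjoint) {k : ℕ}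
    {B : Finset C} (hk : A[k]? = some B) : Disjoint B (allocated (A.take k)) := by
  induction A generalizing k with
  | nil => simp at hk
  | cons B' l ih =>
    rw [List.pairwise_cons] at h
    cases k with
    | zero => simp
    | succ k =>
      simp only [List.getElem?_cons_succ] at hk
      rw [List.take_succ_cons, allocated_cons, Finset.disjoint_union_right]
      exact ⟨(h.1 B (List.mem_of_getElem? hk)).symm, ih h.2 hk⟩

lemma FirstFitValid.firstFit (hv : ∀ c, 0 ≤ v c) {t : ChoreTuple C} (h : FirstFitValid v τ t) :
    FirstFit v τ t.bundles t.items := by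
  have hτ : 0 ≤ τ := (mms_nonneg _ _ _).trans h.threshold
  rw [firstFit_iff]
  intro k B hk
  -- A single greedily filled bin is a benchmark bundle, so comparing with it loses nothing.
  obtain ⟨D, hlen, hD⟩ := exists_greedy hv hτ (t.items \ allocated (t.bundles.take k)) 1
  obtain ⟨G, rfl⟩ := List.length_eq_one_iff.1 hlen
  have hG : ∀ B', B' ⊆ t.items \ allocated (t.bundles.take k) → cost v B' ≤ τ → LexLE v B' G :=
    fun B' h1 h2 => hD.firstFit.1.lexLE hv h1 h2
  have h1 := h.lex_ge k B hk G ⟨⟨hD.1.1, hD.1.2.1⟩, hG⟩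
  refine Packed.of_lexLE hv ?_ fun B' h2 h3 => (hG B' h2 h3).trans h1
  intro x hx
  exact Finset.mem_sdiff.2 ⟨h.collection.subset B (List.mem_of_getElem? hk) hx,
    Finset.disjoint_left.1 (take_disjoint_of_getElem? h.collection.disjoint hk) hx⟩

lemma FirstFit.firstFitValid (hv : ∀ c, 0 ≤ v c) {t : ChoreTuple C}
    (hc : IsBundleCollection t.items t.bundles) (hτ : mms v t.items t.bundles.length ≤ τ)
    (h : FirstFit v τ t.bundles t.items) : FirstFitValid v τ t :=
  ⟨hc, hτ, fun k B hk _ hB' => (firstFit_iff.1 h k B hk).lexLE hv hB'.1.1 hB'.1.2⟩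

/-! ### Partitions and bundle collections -/

lemma isBundleCollection_cons {M B : Finset C} {l : List (Finset C)} :
    IsBundleCollection M (B :: l) ↔ B ⊆ M ∧ IsBundleCollection (M \ B) l := by
  constructor
  · rintro ⟨h1, h2⟩
    rw [List.pairwise_cons] at h2
    refine ⟨h1 B (by simp), fun B' hB' x hx => ?_, h2.2⟩
    exact Finset.mem_sdiff.2 ⟨h1 B' (by simp [hB']) hx,
      fun hx' => Finset.disjoint_left.1 (h2.1 B' hB') hx' hx⟩
  · rintro ⟨h1, h2⟩
    refine ⟨fun B' hB' => ?_, List.pairwise_cons.2 ⟨fun B' hB' => ?_, h2.disjoint⟩⟩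
    · rcases List.mem_cons.1 hB' with rfl | hB'
      · exact h1
      · exact (h2.subset B' hB').trans Finset.sdiff_subset
    · exact (Finset.sdiff_disjoint.mono_left (h2.subset B' hB')).symm

lemma IsBundleCollection.eraseIdx {M A : Finset C} {l : List (Finset C)}
    (h : IsBundleCollection M l) {k : ℕ} (hk : l[k]? = some A) :
    IsBundleCollection (M \ A) (l.eraseIdx k) := by
  induction l generalizing M k with
  | nil => simp at hk
  | cons B l ih =>
    rw [isBundleCollection_cons] at h
    cases k with
    | zero =>
      simp only [List.getElem?_cons_zero, Option.some.injEq] at hk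
      subst hk
      exact h.2
    | succ k =>
      simp only [List.getElem?_cons_succ] at hk
      rw [List.eraseIdx_cons_succ, isBundleCollection_cons, sdiff_right_comm]
      refine ⟨fun x hx => Finset.mem_sdiff.2 ⟨h.1 hx, fun hx' => ?_⟩, ih h.2 hk⟩
      exact (Finset.mem_sdiff.1 (h.2.subset A (List.mem_of_getElem? hk) hx')).2 hx

lemma mem_eraseIdx_of_mem {l : List (Finset C)} {k : ℕ} {A B : Finset C} (hk : l[k]? = some A)
    (hB : B ∈ l) {x : C} (hx : x ∈ B) (hxA : x ∉ A) : B ∈ l.eraseIdx k := by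
  obtain ⟨i, hi⟩ := List.mem_iff_getElem?.1 hB
  refine List.mem_eraseIdx_iff_getElem?.2 ⟨i, ?_, hi⟩
  rintro rfl
  rw [hk, Option.some.injEq] at hi
  exact hxA (hi ▸ hx)

lemma IsComplete.eraseIdx {M A : Finset C} {l : List (Finset C)}
    (h : IsComplete M l) {k : ℕ} (hk : l[k]? = some A) : IsComplete (M \ A) (l.eraseIdx k) := by
  refine { h.toIsBundleCollection.eraseIdx hk with covers := ?_ }
  have h1 := h.toIsBundleCollection.eraseIdx hk
  ext x
  constructor
  · intro hx
    obtain ⟨B, hB, hx⟩ := mem_allocated.1 hx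
    exact h1.subset B hB hx
  · intro hx
    rw [Finset.mem_sdiff, ← h.covers, mem_allocated] at hx
    obtain ⟨⟨B, hB, hx⟩, hxA⟩ := hx
    exact mem_allocated.2 ⟨B, mem_eraseIdx_of_mem hk hB hx hxA, hx⟩

lemma isComplete_iff {M : Finset C} {P : List (Finset C)} : IsComplete M P ↔
    (∀ (i : ℕ) Q, P[i]? = some Q → Q ⊆ M) ∧
    (∀ (x : C) (i j : ℕ) Q Q', P[i]? = some Q → P[j]? = some Q' → x ∈ Q → x ∈ Q' → i = j) ∧
    ∀ x ∈ M, ∃ (i : ℕ) (Q : Finset C), P[i]? = some Q ∧ x ∈ Q := by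
  constructor
  · intro h
    refine ⟨fun i Q hi => h.subset Q (List.mem_of_getElem? hi), ?_, fun x hx => ?_⟩
    · intro x i j Q Q' hi hj hx hx'
      have hd := List.pairwise_iff_getElem.1 h.disjoint
      rw [List.getElem?_eq_some_iff] at hi hj
      obtain ⟨hi, rfl⟩ := hi
      obtain ⟨hj, rfl⟩ := hj
      rcases lt_trichotomy i j with hij | hij | hij
      · exact absurd hx' (Finset.disjoint_left.1 (hd i j hi hj hij) hx)
      · exact hij
      · exact absurd hx (Finset.disjoint_left.1 (hd j i hj hi hij) hx')
    · rw [← h.covers, mem_allocated] at hx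
      obtain ⟨Q, hQ, hx⟩ := hx
      obtain ⟨i, hi⟩ := List.mem_iff_getElem?.1 hQ
      exact ⟨i, Q, hi, hx⟩
  · rintro ⟨h1, h2, h3⟩
    refine { subset := fun B hB => ?_, disjoint := ?_, covers := ?_ }
    · obtain ⟨i, hi⟩ := List.mem_iff_getElem?.1 hB
      exact h1 i B hi
    · rw [List.pairwise_iff_getElem]
      intro i j hi hj hij
      rw [Finset.disjoint_left]
      intro x hx hx'
      exact hij.ne (h2 x i j _ _ (List.getElem?_eq_getElem hi) (List.getElem?_eq_getElem hj) hx hx')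
    · ext x
      rw [mem_allocated]
      constructor
      · rintro ⟨B, hB, hx⟩
        obtain ⟨i, hi⟩ := List.mem_iff_getElem?.1 hB
        exact h1 i B hi hx
      · intro hx
        obtain ⟨i, Q, hi, hx⟩ := h3 x hx
        exact ⟨Q, List.mem_of_getElem? hi, hx⟩

/-! ### The exchange loop -/

lemma getElem?_moveTo (P : List (Finset C)) (S : Finset C) (r i : ℕ) :
    (moveTo P S r)[i]? = P[i]?.map (fun Q => if i = r then Q ∪ S else Q \ S) := by
  rw [moveTo, List.getElem?_modify, List.getElem?_map, Option.map_eq_map, Option.map_map]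
  by_cases h : i = r
  · subst h
    simp [Function.comp_def]
  · simp [h, Ne.symm h, Function.comp_def]

@[simp] lemma length_moveTo (P : List (Finset C)) (S : Finset C) (r : ℕ) :
    (moveTo P S r).length = P.length := by
  simp [moveTo]

lemma IsComplete.moveTo {M S : Finset C} {P : List (Finset C)} (h : IsComplete M P) (hS : S ⊆ M)
    {r : ℕ} (hr : r < P.length) : IsComplete M (moveTo P S r) := by
  rw [isComplete_iff] at h ⊢
  obtain ⟨h1, h2, h3⟩ := h
  refine ⟨?_, ?_, ?_⟩
  · intro i Q hi x hx
    rw [getElem?_moveTo, Option.map_eq_some_iff] at hi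
    obtain ⟨Q', hQ', rfl⟩ := hi
    have := h1 i Q' hQ'
    split_ifs at hx
    · rcases Finset.mem_union.1 hx with hx | hx
      · exact this hx
      · exact hS hx
    · exact this (Finset.mem_sdiff.1 hx).1
  · intro x i j Q Q' hi hj hx hx'
    rw [getElem?_moveTo, Option.map_eq_some_iff] at hi hj
    obtain ⟨R, hR, rfl⟩ := hi
    obtain ⟨R', hR', rfl⟩ := hj
    have := h2 x i j R R' hR hR'
    split_ifs at hx hx' <;> simp only [Finset.mem_union, Finset.mem_sdiff] at hx hx' <;>
      first | omega | tauto
  · intro x hx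
    by_cases hxS : x ∈ S
    · refine ⟨r, P[r] ∪ S, ?_, ?_⟩
      · rw [getElem?_moveTo, List.getElem?_eq_getElem hr]; simp
      · simp [hxS]
    · obtain ⟨i, Q, hi, hxQ⟩ := h3 x hx
      refine ⟨i, if i = r then Q ∪ S else Q \ S, by rw [getElem?_moveTo, hi]; simp, ?_⟩
      split_ifs <;> simp [hxQ, hxS]

/-- The partition `P` of `M` has `n` parts, and those other than part `j` cost at most `μ`. -/
structure CheapExcept (v : C → ℝ) (μ : ℝ) (M : Finset C) (n j : ℕ) (P : List (Finset C)) :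
    Prop where
  complete : IsComplete M P
  length_eq : P.length = n
  cost_le : ∀ (i : ℕ) Q, P[i]? = some Q → i ≠ j → cost v Q ≤ μ

lemma findIdx_part {M : Finset C} {P : List (Finset C)} (h : IsComplete M P) {c : C}
    (hc : c ∈ M) : ∃ Q, P[P.findIdx (fun Q => decide (c ∈ Q))]? = some Q ∧ c ∈ Q := by
  rw [← h.covers, mem_allocated] at hc
  obtain ⟨Q, hQ, hc⟩ := hc
  have hlt : P.findIdx (fun Q => decide (c ∈ Q)) < P.length :=
    List.findIdx_lt_length_of_exists ⟨Q, hQ, by simpa using hc⟩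
  refine ⟨_, List.getElem?_eq_getElem hlt, ?_⟩
  simpa using List.findIdx_getElem (w := hlt)

/-- The part that loses `c` receives in return the preimage of `c`, which costs at most `v c`.
Nothing is claimed about part `j`, which is deleted after the loop. -/
lemma CheapExcept.exchangeOne (hv : ∀ c, 0 ≤ v c) {M : Finset C} {n j : ℕ}
    {P : List (Finset C)} (h : CheapExcept v μ M n j P) (hj : j < n) {f : C → C} {Pj : Finset C}
    (hPj : Pj ⊆ M) {c : C} (hc : c ∈ M) (hf : cost v (Pj.filter (fun x => f x = c)) ≤ v c) :
    CheapExcept v μ M n j (exchangeOne f Pj j P c) := by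
  obtain ⟨R, hR, hcR⟩ := findIdx_part h.complete hc
  rw [ChoreReduction.exchangeOne]
  set r := P.findIdx (fun Q => decide (c ∈ Q)) with hr
  have hrlt : r < P.length := (List.getElem?_eq_some_iff.1 hR).1
  refine ⟨?_, by simp [h.length_eq], ?_⟩
  · refine (h.complete.moveTo (by simpa using hc) (by rw [h.length_eq]; exact hj)).moveTo
      ((Finset.filter_subset _ _).trans hPj) (by simpa using hrlt)
  · intro i Q hi hij
    rw [getElem?_moveTo, getElem?_moveTo, Option.map_map, Option.map_eq_some_iff] at hi
    obtain ⟨Q', hQ', rfl⟩ := hi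
    have hle := h.cost_le i Q' hQ' hij
    simp only [Function.comp_apply, if_neg hij]
    split_ifs with hir
    · subst hir
      rw [hR, Option.some.injEq] at hQ'
      subst hQ'
      have h1 := cost_union_le hv (R \ {c}) (Pj.filter (fun x => f x = c))
      have h2 := cost_erase (v := v) hcR
      rw [Finset.sdiff_singleton_eq_erase] at h1 ⊢
      linarith
    · exact (cost_mono hv (Finset.sdiff_subset.trans Finset.sdiff_subset)).trans hle

lemma CheapExcept.exchange (hv : ∀ c, 0 ≤ v c) {M : Finset C} {n j : ℕ}
    {P : List (Finset C)} (h : CheapExcept v μ M n j P) (hj : j < n) {f : C → C} {Pj : Finset C}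
    (hPj : Pj ⊆ M) {order : List C} (ho : ∀ c ∈ order, c ∈ M ∧
      cost v (Pj.filter (fun x => f x = c)) ≤ v c) :
    CheapExcept v μ M n j (exchange f Pj j order P) := by
  induction order generalizing P with
  | nil => exact h
  | cons c order ih =>
    exact ih (h.exchangeOne hv hj hPj (ho c (by simp)).1 (ho c (by simp)).2)
      fun c' hc' => ho c' (by simp [hc'])

/-- If the domination map fixes the common chores, then the exchange loop works in any order. -/
lemma getElem?_exchange {M A Pj : Finset C} {P : List (Finset C)} {j : ℕ} {f : C → C}
    (hPj : Pj ⊆ M) (hA : A ⊆ M) (hfix : ∀ x ∈ Pj, x ∈ A → f x = x)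
    (hfib : ∀ x ∈ Pj, ∀ y ∈ Pj, x ∈ A → f y = x → y = x) {order : List C} {done : Finset C}
    (hP : IsComplete M P) (hdone : done ⊆ A) (horder : ∀ c ∈ order, c ∈ A ∧ c ∉ done)
    (hnd : order.Nodup) (hj : P[j]? = some (Pj.filter (fun x => f x ∉ done) ∪ done)) :
    (exchange f Pj j order P)[j]? =
      some (Pj.filter (fun x => f x ∉ done ∪ order.toFinset) ∪ (done ∪ order.toFinset)) := by
  induction order generalizing P done with
  | nil => simpa [exchange] using hj
  | cons c order ih =>
    obtain ⟨hcA, hcd⟩ := horder c (by simp)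
    rw [List.nodup_cons] at hnd
    obtain ⟨R, hR, hcR⟩ := findIdx_part hP (hA hcA)
    have hjlt : j < P.length := (List.getElem?_eq_some_iff.1 hj).1
    have hrlt : P.findIdx (fun Q => decide (c ∈ Q)) < P.length :=
      (List.getElem?_eq_some_iff.1 hR).1
    have key := ih (P := exchangeOne f Pj j P c) (done := insert c done)
      ((hP.moveTo (by simpa using hA hcA) hjlt).moveTo
        ((Finset.filter_subset _ _).trans hPj) (by simpa using hrlt))
      (Finset.insert_subset hcA hdone)
      (fun x hx => ⟨(horder x (by simp [hx])).1, by
        rw [Finset.mem_insert, not_or]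
        exact ⟨fun h => hnd.1 (h ▸ hx), (horder x (by simp [hx])).2⟩⟩) hnd.2 ?_
    · have hins : insert c done ∪ order.toFinset = done ∪ (c :: order).toFinset := by
        ext x; simp
      rw [hins] at key
      exact key
    · rw [exchangeOne, getElem?_moveTo, getElem?_moveTo, hj]
      simp only [Option.map_some, if_true, Option.some.injEq]
      by_cases hcP : c ∈ Pj
      · have hr : j = P.findIdx (fun Q => decide (c ∈ Q)) :=
          (isComplete_iff.1 hP).2.1 c _ _ _ _ hj hR (by simp [hcP, hfix c hcP hcA, hcd]) hcR
        rw [if_pos hr]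
        ext x
        simp only [Finset.mem_union, Finset.mem_filter, Finset.mem_insert, Finset.mem_singleton,
          not_or]
        constructor
        · rintro (((h | h) | h) | h)
          · by_cases hx : f x = c
            · exact Or.inr (Or.inl (hfib c hcP x h.1 hcA hx))
            · exact Or.inl ⟨h.1, hx, h.2⟩
          · exact Or.inr (Or.inr h)
          · exact Or.inr (Or.inl h)
          · exact Or.inr (Or.inl (hfib c hcP x h.1 hcA h.2))
        · rintro (h | h | h)
          · exact Or.inl (Or.inl (Or.inl ⟨h.1, h.2.2⟩))
          · exact Or.inl (Or.inr h)
          · exact Or.inl (Or.inl (Or.inr h))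
      · have hr : j ≠ P.findIdx (fun Q => decide (c ∈ Q)) := by
          intro hr
          rw [← hr, hj, Option.some.injEq] at hR
          rw [← hR] at hcR
          simp [hcP, hcd] at hcR
        rw [if_neg hr]
        ext x
        simp only [Finset.mem_union, Finset.mem_filter, Finset.mem_insert, Finset.mem_singleton,
          Finset.mem_sdiff, not_or, not_and]
        constructor
        · rintro ⟨(h | h) | h, h'⟩
          · exact Or.inl ⟨h.1, h' h.1, h.2⟩
          · exact Or.inr (Or.inr h)
          · exact Or.inr (Or.inl h)
        · rintro (h | rfl | h)
          · exact ⟨Or.inl (Or.inl ⟨h.1, h.2.2⟩), fun _ => h.2.1⟩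
          · exact ⟨Or.inr rfl, fun h => absurd h hcP⟩
          -- Chores already brought into part `j` are not moved out again: one that also lies in
          -- `Pj` is its own image, hence not in the preimage of `c`.
          · refine ⟨Or.inl (Or.inr h), fun hx hfx => ?_⟩
            rw [hfix x hx (hdone h)] at hfx
            exact hcd (hfx ▸ h)

/-! ### Domination maps that fix the common chores -/

/-- A domination map with the fewest moved chores fixes all common ones. If it moved a common chore
`x`, one could send `x` to itself and the old preimage of `x`, of cost at most `v x`, to `f x` in
place of `x`. -/
lemma Dominates.exists_fixing (hv : ∀ c, 0 ≤ v c) {A B : Finset C} (h : Dominates v A B) :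
    ∃ f : C → C, IsDominationMap v A B f ∧ ∀ x ∈ B, x ∈ A → f x = x := by
  have hex : ∃ m, ∃ f : C → C, IsDominationMap v A B f ∧
      (B.filter (fun x => f x ≠ x)).card = m := by
    obtain ⟨f, hf⟩ := h
    exact ⟨_, f, hf, rfl⟩
  obtain ⟨f, hf, hm⟩ := Nat.find_spec hex
  refine ⟨f, hf, fun x hxB hxA => ?_⟩
  by_contra hne
  let g : C → C := fun y => if y = x then x else if f y = x then f x else f y
  have hg : IsDominationMap v A B g := by
    refine ⟨fun y hy => ?_, fun c hc => ?_⟩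
    · simp only [g]
      split_ifs
      · exact hxA
      · exact hf.1 x hxB
      · exact hf.1 y hy
    · by_cases hcx : c = x
      · subst hcx
        have : B.filter (fun y => g y = c) ⊆ {c} := by
          intro y hy
          rw [Finset.mem_filter] at hy
          by_contra hyc
          rw [Finset.mem_singleton] at hyc
          have h2 := hy.2
          simp only [g, if_neg hyc] at h2
          split_ifs at h2 with h3
          · exact hne h2
          · exact h3 h2
        exact (cost_mono hv this).trans (by simp [cost])
      · by_cases hcf : c = f x
        · subst hcf
          have h1 := hf.2 (f x) hc
          have h2 := hf.2 x hxA
          have hxm : x ∈ B.filter (fun y => f y = f x) := by simp [hxB]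
          have h3 : B.filter (fun y => g y = f x) ⊆
              (B.filter (fun y => f y = f x)).erase x ∪ B.filter (fun y => f y = x) := by
            intro y hy
            rw [Finset.mem_filter] at hy
            have hyx : y ≠ x := by
              rintro rfl
              have := hy.2
              simp only [g, if_true] at this
              exact hne this.symm
            have h4 := hy.2
            simp only [g, if_neg hyx] at h4
            split_ifs at h4 with h5
            · simp [hy.1, h5]
            · simp [hy.1, h4, hyx]
          have h4 := (cost_mono hv h3).trans (cost_union_le hv _ _)
          have h5 := cost_erase (v := v) hxm
          linarith
        · refine (cost_mono hv ?_).trans (hf.2 c hc)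
          intro y hy
          rw [Finset.mem_filter] at hy ⊢
          refine ⟨hy.1, ?_⟩
          have h4 := hy.2
          simp only [g] at h4
          split_ifs at h4 with h5 h6
          · exact absurd h4.symm hcx
          · exact absurd h4.symm hcf
          · exact h4
  refine Nat.find_min hex (m := (B.filter (fun y => g y ≠ y)).card) ?_ ⟨g, hg, rfl⟩
  rw [← hm]
  apply Finset.card_lt_card
  rw [Finset.ssubset_iff_of_subset]
  · exact ⟨x, by simp [hxB, hne], by simp [g]⟩
  · intro y hy
    rw [Finset.mem_filter] at hy ⊢
    refine ⟨hy.1, fun hfy => hy.2 ?_⟩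
    simp only [g]
    split_ifs with h1 h2
    · exact h1.symm
    · exact absurd (hfy.symm.trans h2) h1
    · exact hfy

lemma exists_dominationStep (hv : ∀ c, 0 ≤ v c) {s : TidyState C}
    (hpos : ∀ x ∈ s.items, 0 < v x) (hb : IsBundleCollection s.items s.bundles)
    (hp : IsComplete s.items s.parts)
    (h : ∃ Ak ∈ s.bundles, ∃ Pj ∈ s.parts, Dominates v Ak Pj) :
    ∃ s', DominationStep v s s' := by
  obtain ⟨A, hA, Q, hQ, hdom⟩ := h
  obtain ⟨f, hf, hfix⟩ := hdom.exists_fixing hv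
  obtain ⟨k, hk⟩ := List.mem_iff_getElem?.1 hA
  obtain ⟨j, hj⟩ := List.mem_iff_getElem?.1 hQ
  refine ⟨_, k, j, A, Q, f, A.toList, hk, hj, hf, A.nodup_toList, by simp, ?_, rfl⟩
  have key := getElem?_exchange (hp.subset Q hQ) (hb.subset A hA) hfix ?_ (order := A.toList)
    (done := ∅) hp (by simp) (by simp) A.nodup_toList (by simpa using hj)
  · rw [key]
    simp only [Finset.toList_toFinset, Finset.empty_union, Option.some.injEq]
    rw [Finset.filter_false_of_mem, Finset.empty_union]
    exact fun x hx => not_not.2 (hf.1 x hx)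
  -- The fixed chore `x` alone uses up the capacity `v x`, so by positivity its preimage contains
  -- nothing else.
  · intro x hx y hy hxA hyx
    by_contra hne
    have h1 := hf.2 x hxA
    have h2 : ({x, y} : Finset C) ⊆ Q.filter (fun z => f z = x) := by
      intro z hz
      rcases Finset.mem_insert.1 hz with rfl | hz
      · simp [hx, hfix _ hx hxA]
      · rw [Finset.mem_singleton] at hz
        subst hz
        simp [hy, hyx]
    have h3 := cost_mono hv h2
    rw [cost, Finset.sum_pair (Ne.symm hne)] at h3
    linarith [hpos y (hp.subset Q hQ hy)]

variable {c : C} {prec : C → C → Prop}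

/-! ### Removing chores -/

lemma allocated_map_sdiff (A : List (Finset C)) (R : Finset C) :
    allocated (A.map (fun B => B \ R)) = allocated A \ R := by
  ext x
  simp only [mem_allocated, List.mem_map, Finset.mem_sdiff]
  constructor
  · rintro ⟨_, ⟨B, hB, rfl⟩, hx⟩
    rw [Finset.mem_sdiff] at hx
    exact ⟨⟨B, hB, hx.1⟩, hx.2⟩
  · rintro ⟨⟨B, hB, hx⟩, hxR⟩
    exact ⟨_, ⟨B, hB, rfl⟩, Finset.mem_sdiff.2 ⟨hx, hxR⟩⟩

lemma IsBundleCollection.map_sdiff {M : Finset C} {A : List (Finset C)}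
    (h : IsBundleCollection M A) (R : Finset C) :
    IsBundleCollection (M \ R) (A.map (fun B => B \ R)) := by
  refine ⟨fun B hB => ?_, ?_⟩
  · obtain ⟨B', hB', rfl⟩ := List.mem_map.1 hB
    exact Finset.sdiff_subset_sdiff (h.subset B' hB') le_rfl
  · exact List.Pairwise.map _ (fun _ _ hd => hd.mono Finset.sdiff_subset Finset.sdiff_subset)
      h.disjoint

lemma IsComplete.map_sdiff {M : Finset C} {A : List (Finset C)}
    (h : IsComplete M A) (R : Finset C) : IsComplete (M \ R) (A.map (fun B => B \ R)) :=
  { h.toIsBundleCollection.map_sdiff R with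
    covers := by rw [allocated_map_sdiff, h.covers] }

lemma FirstFit.map_sdiff {l : List (Finset C)} {S R : Finset C} (h : FirstFit v τ l S)
    (hR : ∀ B ∈ l, ∀ T ⊆ S, Packed v τ B T → Packed v τ (B \ R) (T \ R)) :
    FirstFit v τ (l.map (fun B => B \ R)) (S \ R) := by
  induction l generalizing S with
  | nil => trivial
  | cons B l ih =>
    refine ⟨hR B (by simp) S le_rfl h.1, ?_⟩
    have h1 : (S \ R) \ (B \ R) = (S \ B) \ R := by
      ext x; simp only [Finset.mem_sdiff]; tauto
    change FirstFit v τ (l.map (fun B => B \ R)) ((S \ R) \ (B \ R))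
    rw [h1]
    exact ih h.2 fun B' hB' T hT => hR B' (by simp [hB']) T (hT.trans Finset.sdiff_subset)

/-- The number of bundles that cost more than `τ`. -/
noncomputable def excess (v : C → ℝ) (τ : ℝ) (A : List (Finset C)) : ℕ :=
  A.countP (fun B => decide (τ < cost v B))

lemma excess_map_sdiff_le (hv : ∀ c, 0 ≤ v c) (A : List (Finset C)) (R : Finset C) :
    excess v τ (A.map (fun B => B \ R)) ≤ excess v τ A := by
  rw [excess, List.countP_map]
  refine List.countP_mono_left fun B _ hB => ?_
  simp only [Function.comp_apply, decide_eq_true_eq] at hB ⊢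
  exact hB.trans_le (cost_mono hv Finset.sdiff_subset)

/-! ### The state during the Tidy-Up Procedure -/

/-- The properties that every step of the Tidy-Up Procedure preserves. -/
structure Tidying (v : C → ℝ) (τ μ : ℝ) (c : C) (s : TidyState C) : Prop where
  collection : IsBundleCollection s.items s.bundles
  firstFit : FirstFit v τ s.bundles s.items
  mem : c ∈ s.items
  unalloc : c ∉ allocated s.bundles
  complete : IsComplete s.items s.parts
  parts_le : ∀ Q ∈ s.parts, cost v Q ≤ μ
  length_eq : s.parts.length = s.bundles.length

lemma FirstFit.lt_cost_atLeast_add {l : List (Finset C)} {S : Finset C}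
    (h : FirstFit v τ l S) (hc : c ∈ S) (hcl : c ∉ allocated l) (hpos : 0 < v c) :
    ∀ B ∈ l, τ < cost v (atLeast v B (v c)) + v c := by
  induction l generalizing S with
  | nil => simp
  | cons B l ih =>
    rw [allocated_cons, Finset.mem_union, not_or] at hcl
    intro B' hB'
    rcases List.mem_cons.1 hB' with rfl | hB'
    · exact h.1 c hc hcl.1 hpos
    · exact ih h.2 (Finset.mem_sdiff.2 ⟨hc, hcl.1⟩) hcl.2 B' hB'

/-- If `μ + v c ≤ τ`, the rejection of `c` makes every bundle cost more than `μ`. With `c` itself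
the chores then cost more than the number of parts times `μ`, contradicting the partition. -/
lemma Tidying.lt_add (hv : ∀ c, 0 ≤ v c) {s : TidyState C} (h : Tidying v τ μ c s)
    (hpos : 0 < v c) : τ < μ + v c := by
  by_contra! hle
  have h1 : ∀ B ∈ s.bundles, τ < cost v B + v c := fun B hB =>
    (h.firstFit.lt_cost_atLeast_add h.mem h.unalloc hpos B hB).trans_le
      (add_le_add_left (cost_mono hv (atLeast_subset _ _)) _)
  have h2 : (s.bundles.map (cost v)).length • μ ≤ (s.bundles.map (cost v)).sum := by
    apply List.card_nsmul_le_sum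
    intro x hx
    obtain ⟨B, hB, rfl⟩ := List.mem_map.1 hx
    linarith [h1 B hB]
  have h3 : (s.parts.map (cost v)).sum ≤ (s.parts.map (cost v)).length • μ := by
    apply List.sum_le_card_nsmul
    intro x hx
    obtain ⟨B, hB, rfl⟩ := List.mem_map.1 hx
    exact h.parts_le B hB
  rw [← cost_allocated h.collection.disjoint] at h2
  rw [← cost_allocated h.complete.disjoint, h.complete.covers] at h3
  have h4 : cost v (insert c (allocated s.bundles)) ≤ cost v s.items := by
    refine cost_mono hv (Finset.insert_subset h.mem fun x hx => ?_)
    obtain ⟨B, hB, hx⟩ := mem_allocated.1 hx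
    exact h.collection.subset B hB hx
  rw [cost_insert h.unalloc] at h4
  simp only [List.length_map] at h2 h3
  rw [h.length_eq] at h3
  linarith

lemma Tidying.remove (hv : ∀ c, 0 ≤ v c) {s : TidyState C} (h : Tidying v τ μ c s)
    {R : Finset C} (hc : c ∉ R)
    (hR : ∀ B ∈ s.bundles, ∀ T ⊆ s.items, Packed v τ B T → Packed v τ (B \ R) (T \ R)) :
    Tidying v τ μ c (s.remove R) where
  collection := h.collection.map_sdiff R
  firstFit := h.firstFit.map_sdiff hR
  mem := Finset.mem_sdiff.2 ⟨h.mem, hc⟩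
  unalloc := by
    rw [TidyState.remove, allocated_map_sdiff]
    exact fun hx => h.unalloc (Finset.mem_sdiff.1 hx).1
  complete := h.complete.map_sdiff R
  parts_le := fun Q hQ => by
    obtain ⟨Q', hQ', rfl⟩ := List.mem_map.1 hQ
    exact (cost_mono hv Finset.sdiff_subset).trans (h.parts_le Q' hQ')
  length_eq := by simpa [TidyState.remove] using h.length_eq

lemma Tidying.removeUnallocated (hv : ∀ c, 0 ≤ v c) {s : TidyState C}
    (h : Tidying v τ μ c s) : Tidying v τ μ c (s.removeUnallocated c) := by
  refine h.remove hv (by simp) fun B hB T _ hBT => ?_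
  have : B \ ((s.items \ allocated s.bundles) \ {c}) = B := by
    refine Finset.sdiff_eq_self_iff_disjoint.2 (Finset.disjoint_left.2 fun x hx hx' => ?_)
    simp only [Finset.mem_sdiff] at hx'
    exact hx'.1.2 (mem_allocated.2 ⟨B, hB, hx⟩)
  rw [this]
  exact hBT.mono Finset.sdiff_subset

lemma removeUnallocated_mem {s : TidyState C} {x : C}
    (hx : x ∈ (s.removeUnallocated c).items) :
    x = c ∨ x ∈ allocated (s.removeUnallocated c).bundles := by
  simp only [TidyState.removeUnallocated, TidyState.remove, allocated_map_sdiff,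
    Finset.mem_sdiff, Finset.mem_singleton] at hx ⊢
  tauto

/-- A surviving chore `x` is at least as large as `c`, so none of the removed chores counted in the
test for `x`. -/
lemma Tidying.removeSmaller (hv : ∀ c, 0 ≤ v c) {s : TidyState C}
    (h : Tidying v τ μ c s) : Tidying v τ μ c (s.removeSmaller v c) := by
  refine h.remove hv (by simp) fun B hB T hT hBT => fun x hx hxB hpos => ?_
  rw [Finset.mem_sdiff, Finset.mem_filter, not_and, not_lt] at hx
  have hxc := hx.2 (hT hx.1)
  have h1 := hBT x hx.1 (fun h' => hxB (Finset.mem_sdiff.2 ⟨h', by simp [hxc]⟩)) hpos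
  refine h1.trans_le ?_
  gcongr
  refine cost_mono hv fun y hy => ?_
  rw [mem_atLeast] at hy ⊢
  exact ⟨Finset.mem_sdiff.2 ⟨hy.1, by simpa using fun _ => hxc.trans hy.2⟩, hy.2⟩

lemma exists_first_of_nonempty {r : C → C → Prop} (hirr : ∀ a, ¬ r a a)
    (htr : ∀ a b c, r a b → r b c → r a c) {S : Finset C} (hS : S.Nonempty) :
    ∃ x ∈ S, ∀ y ∈ S, ¬ r y x := by
  induction hS using Finset.Nonempty.cons_induction with
  | singleton a => exact ⟨a, by simp, fun y hy => by
      rw [Finset.mem_singleton.1 hy]; exact hirr a⟩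
  | cons a s ha hs ih =>
    obtain ⟨x, hx, hmin⟩ := ih
    by_cases hax : r a x
    · refine ⟨a, by simp, fun y hy hya => ?_⟩
      rcases Finset.mem_cons.1 hy with rfl | hy
      · exact hirr _ hya
      · exact hmin y hy (htr _ _ _ hya hax)
    · refine ⟨x, by simp [hx], fun y hy => ?_⟩
      rcases Finset.mem_cons.1 hy with rfl | hy
      · exact hax
      · exact hmin y hy

lemma le_of_prec (hprec : IsUniversalOrdering v prec) {a b : C} (h : prec a b) : v b ≤ v a := by
  by_contra! hlt
  exact hprec.irrefl _ (hprec.trans _ _ _ h (hprec.antitone b a hlt))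

/-- If all chores removed from a bundle are cheaper than `x`, the test for `x` is unchanged.
Otherwise every kept chore is at least as large as `x`, and the kept chores cost at least `μ`, so
adding `x` costs at least `μ + v c > τ`. -/
lemma Tidying.removeRedundant (hv : ∀ c, 0 ≤ v c) (hprec : IsUniversalOrdering v prec)
    (hpos : 0 < v c) {s : TidyState C} (h : Tidying v τ μ c s) (hge : ∀ x ∈ s.items, v c ≤ v x) :
    Tidying v τ μ c (s.removeRedundant prec v μ) := by
  have hlt := h.lt_add hv hpos
  refine h.remove hv ?_ fun B hB T hT hBT => ?_
  · rw [Finset.mem_filter, not_and, not_exists]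
    rintro - B ⟨hB, hB'⟩
    exact h.unalloc (mem_allocated.2 ⟨B, hB, hB'.1⟩)
  set R := s.items.filter (fun x => ∃ B ∈ s.bundles, IsRedundant prec v μ B x) with hR
  have hmemR : ∀ x ∈ B, x ∈ R ↔ IsRedundant prec v μ B x := by
    intro x hx
    rw [hR, Finset.mem_filter]
    constructor
    · rintro ⟨-, B', hB', hred⟩
      rwa [eq_of_mem_of_mem h.collection.disjoint hB hB' hx hred.1]
    · exact fun hred => ⟨h.collection.subset B hB hx, B, hB, hred⟩
  intro x hx hxB hxpos
  rw [Finset.mem_sdiff] at hx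
  have hxB' : x ∉ B := fun h' => hxB (Finset.mem_sdiff.2 ⟨h', hx.2⟩)
  have h1 := hBT x hx.1 hxB' hxpos
  by_cases hsmall : ∀ y ∈ B, y ∈ R → v y < v x
  · refine h1.trans_le ?_
    gcongr
    refine cost_mono hv fun y hy => ?_
    rw [mem_atLeast] at hy ⊢
    exact ⟨Finset.mem_sdiff.2 ⟨hy.1, fun hyR => absurd hy.2 (not_le.2 (hsmall y hy.1 hyR))⟩, hy.2⟩
  · push Not at hsmall
    obtain ⟨r, hrB, hrR, hxr⟩ := hsmall
    have hkept : ∀ y ∈ B \ R, ∀ z ∈ B, z ∈ R → prec y z := by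
      intro y hy z hz hzR
      rw [Finset.mem_sdiff] at hy
      rcases hprec.total y z (by rintro rfl; exact hy.2 hzR) with h2 | h2
      · exact h2
      · exfalso
        refine hy.2 ((hmemR y hy.1).2 ⟨hy.1, ((hmemR z hz).1 hzR).2.trans (cost_mono hv ?_)⟩)
        intro w hw
        rw [Finset.mem_filter] at hw ⊢
        exact ⟨hw.1, hprec.trans _ _ _ hw.2 h2⟩
    have hall : atLeast v (B \ R) (v x) = B \ R := atLeast_eq_self fun y hy =>
      hxr.trans (le_of_prec hprec (hkept y hy r hrB hrR))
    -- All chores before the first redundant chore `z` are kept, and they already cost `μ`.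
    obtain ⟨z, hz, hzmin⟩ := exists_first_of_nonempty hprec.irrefl hprec.trans
      (S := B ∩ R) ⟨r, Finset.mem_inter.2 ⟨hrB, hrR⟩⟩
    rw [Finset.mem_inter] at hz
    have h2 : μ ≤ cost v (B \ R) := by
      refine ((hmemR z hz.1).1 hz.2).2.trans (cost_mono hv fun w hw => ?_)
      rw [Finset.mem_filter] at hw
      exact Finset.mem_sdiff.2 ⟨hw.1, fun hwR => hzmin w (Finset.mem_inter.2 ⟨hw.1, hwR⟩) hw.2⟩
    rw [hall]
    have h3 := hge x (hT hx.1)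
    linarith

/-- The properties that hold after the removals of the Tidy-Up Procedure. -/
structure Tidy (prec : C → C → Prop) (v : C → ℝ) (τ μ : ℝ) (c : C) (s : TidyState C) : Prop
    extends Tidying v τ μ c s where
  ge : ∀ x ∈ s.items, v c ≤ v x
  eq_or_mem : ∀ x ∈ s.items, x = c ∨ x ∈ allocated s.bundles
  nonredundant : ∀ B ∈ s.bundles, ∀ x ∈ B, cost v (B.filter (fun y => prec y x)) < μ

lemma eq_or_mem_remove {s : TidyState C} (h : ∀ x ∈ s.items, x = c ∨ x ∈ allocated s.bundles)
    (R : Finset C) : ∀ x ∈ (s.remove R).items, x = c ∨ x ∈ allocated (s.remove R).bundles := by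
  intro x hx
  rw [TidyState.remove, Finset.mem_sdiff] at hx
  rw [TidyState.remove, allocated_map_sdiff, Finset.mem_sdiff]
  have := h x hx.1
  tauto

lemma Tidying.tidy (hv : ∀ c, 0 ≤ v c) (hprec : IsUniversalOrdering v prec)
    (hpos : 0 < v c) {s : TidyState C} (h : Tidying v τ μ c s) :
    Tidy prec v τ μ c (((s.removeUnallocated c).removeSmaller v c).removeRedundant prec v μ) := by
  have h1 := h.removeUnallocated hv
  have h2 := h1.removeSmaller hv
  have hge : ∀ x ∈ ((s.removeUnallocated c).removeSmaller v c).items, v c ≤ v x := by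
    intro x hx
    rw [TidyState.removeSmaller, TidyState.remove, Finset.mem_sdiff, Finset.mem_filter,
      not_and, not_lt] at hx
    exact hx.2 hx.1
  refine { h2.removeRedundant hv hprec hpos hge with
    ge := fun x hx => hge x (Finset.mem_sdiff.1 hx).1
    eq_or_mem := eq_or_mem_remove (eq_or_mem_remove (fun x hx => removeUnallocated_mem hx) _) _
    nonredundant := ?_ }
  intro B' hB' x hx
  obtain ⟨B, hB, rfl⟩ := List.mem_map.1 hB'
  rw [Finset.mem_sdiff, Finset.mem_filter, not_and] at hx
  have h3 : ¬ IsRedundant prec v μ B x := fun hred =>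
    hx.2 (h2.collection.subset B hB hx.1) ⟨B, hB, hred⟩
  rw [IsRedundant, not_and, not_le] at h3
  exact (cost_mono hv (Finset.filter_subset_filter _ Finset.sdiff_subset)).trans_lt (h3 hx.1)

lemma Tidy.dominationStep (hv : ∀ c, 0 ≤ v c) {s s' : TidyState C} (h : Tidy prec v τ μ c s)
    (hs : DominationStep v s s') : Tidy prec v τ μ c s' := by
  obtain ⟨k, j, A, Q, f, order, hk, hj, hf, hnd, ho, hex, rfl⟩ := hs
  have hAmem := List.mem_of_getElem? hk
  have hA := h.collection.subset A hAmem
  have hc : c ∉ A := fun hc => h.unalloc (mem_allocated.2 ⟨A, hAmem, hc⟩)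
  have hcheap : CheapExcept v μ s.items s.parts.length j s.parts :=
    ⟨h.complete, rfl, fun i Q hi _ => h.parts_le Q (List.mem_of_getElem? hi)⟩
  have hcheap := hcheap.exchange hv (List.getElem?_eq_some_iff.1 hj).1
    (h.complete.subset Q (List.mem_of_getElem? hj)) (order := order) (f := f) (fun x hx => by
      have : x ∈ A := by rw [← ho]; simpa using hx
      exact ⟨hA this, hf.2 x this⟩)
  have hsub : ∀ B ∈ s.bundles.eraseIdx k, B ∈ s.bundles :=
    fun B hB => List.mem_of_mem_eraseIdx hB
  refine { collection := h.collection.eraseIdx hk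
           firstFit := h.firstFit.eraseIdx hk
           mem := Finset.mem_sdiff.2 ⟨h.mem, hc⟩
           unalloc := fun hx => ?_
           complete := hcheap.complete.eraseIdx hex
           parts_le := fun Q' hQ' => ?_
           length_eq := ?_
           ge := fun x hx => h.ge x (Finset.mem_sdiff.1 hx).1
           eq_or_mem := fun x hx => ?_
           nonredundant := fun B hB => h.nonredundant B (hsub B hB) }
  · obtain ⟨B, hB, hx⟩ := mem_allocated.1 hx
    exact h.unalloc (mem_allocated.2 ⟨B, hsub B hB, hx⟩)
  -- The only part without a cost bound is the deleted one.
  · obtain ⟨i, hij, hi⟩ := List.mem_eraseIdx_iff_getElem?.1 hQ'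
    exact hcheap.cost_le i Q' hi hij
  · have h1 := (List.getElem?_eq_some_iff.1 hk).1
    have h2 := (List.getElem?_eq_some_iff.1 hj).1
    rw [List.length_eraseIdx_of_lt h1, List.length_eraseIdx_of_lt (by rwa [hcheap.length_eq]),
      hcheap.length_eq, h.length_eq]
  · rw [Finset.mem_sdiff] at hx
    refine (h.eq_or_mem x hx.1).imp_right fun hx' => ?_
    obtain ⟨B, hB, hxB⟩ := mem_allocated.1 hx'
    exact mem_allocated.2 ⟨B, mem_eraseIdx_of_mem hk hB hxB hx.2, hxB⟩

lemma Tidy.reflTransGen (hv : ∀ c, 0 ≤ v c) {s s' : TidyState C} (h : Tidy prec v τ μ c s)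
    (hs : Relation.ReflTransGen (DominationStep v) s s') : Tidy prec v τ μ c s' := by
  induction hs with
  | refl => exact h
  | tail _ hstep ih => exact ih.dominationStep hv hstep

lemma DominationStep.sublist {s s' : TidyState C} (hs : DominationStep v s s') :
    s'.bundles.Sublist s.bundles ∧ s'.bundles.length < s.bundles.length := by
  obtain ⟨k, j, A, Q, f, order, hk, -, -, -, -, -, rfl⟩ := hs
  have h1 := (List.getElem?_eq_some_iff.1 hk).1
  refine ⟨List.eraseIdx_sublist _ _, ?_⟩
  rw [List.length_eraseIdx_of_lt h1]
  omega

lemma sublist_of_reflTransGen {s s' : TidyState C}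
    (hs : Relation.ReflTransGen (DominationStep v) s s') : s'.bundles.Sublist s.bundles := by
  induction hs with
  | refl => exact List.Sublist.refl _
  | tail _ hstep ih => exact hstep.sublist.1.trans ih

lemma Tidy.exists_undominated (hv : ∀ c, 0 ≤ v c) (hpos : 0 < v c) {s : TidyState C}
    (h : Tidy prec v τ μ c s) : ∃ s', Relation.ReflTransGen (DominationStep v) s s' ∧
      ¬ ∃ Ak ∈ s'.bundles, ∃ Pj ∈ s'.parts, Dominates v Ak Pj := by
  induction hn : s.bundles.length using Nat.strong_induction_on generalizing s with
  | _ n ih =>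
    subst hn
    by_cases hd : ∃ Ak ∈ s.bundles, ∃ Pj ∈ s.parts, Dominates v Ak Pj
    · obtain ⟨s₁, hs₁⟩ := exists_dominationStep hv (fun x hx => hpos.trans_le (h.ge x hx))
        h.collection h.complete hd
      obtain ⟨s', h1, h2⟩ := ih _ hs₁.sublist.2 (h.dominationStep hv hs₁) rfl
      exact ⟨s', Relation.ReflTransGen.head hs₁ h1, h2⟩
    · exact ⟨s, Relation.ReflTransGen.refl, hd⟩

/-! ### The Tidy-Up Procedure -/

/-- The properties of the tuples on which the Tidy-Up Procedure is called. -/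
structure Admissible (v : C → ℝ) (τ μ : ℝ) (c : C) (t : ChoreTuple C) : Prop where
  collection : IsBundleCollection t.items t.bundles
  firstFit : FirstFit v τ t.bundles t.items
  mem : c ∈ t.items
  unalloc : c ∉ allocated t.bundles
  length_pos : 1 ≤ t.bundles.length
  mms_le : mms v t.items t.bundles.length ≤ μ

lemma Admissible.tidying {t : ChoreTuple C} (h : Admissible v τ μ c t)
    {P : List (Finset C)} (hlen : P.length = t.bundles.length) (hP : IsComplete t.items P)
    {x : ℝ} (hx : ∀ Q ∈ P, cost v Q ≤ x) : Tidying v τ x c ⟨t.items, t.bundles, P⟩ :=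
  ⟨h.collection, h.firstFit, h.mem, h.unalloc, hP, hx, hlen⟩

lemma Admissible.exists_tidyUp (hv : ∀ c, 0 ≤ v c) (hprec : IsUniversalOrdering v prec)
    (hpos : 0 < v c) {t : ChoreTuple C} (h : Admissible v τ μ c t) :
    ∃ t', TidyUp prec v c t t' := by
  obtain ⟨P, hlen, hP, hle⟩ := exists_partition v t.items h.length_pos
  obtain ⟨s, h1, h2⟩ := ((h.tidying hlen hP hle).tidy hv hprec hpos).exists_undominated hv hpos
  exact ⟨_, P, s, hlen, hP, hle, h1, h2, rfl⟩

/-- `P` is a partition that witnesses that the tuple `t` is tidy. -/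
structure IsTidied (prec : C → C → Prop) (v : C → ℝ) (τ μ : ℝ) (c : C) (t : ChoreTuple C)
    (P : List (Finset C)) : Prop extends Tidy prec v τ μ c ⟨t.items, t.bundles, P⟩ where
  undominated : ∀ A ∈ t.bundles, ∀ Q ∈ P, ¬ Dominates v A Q

lemma Admissible.tidyUp (hv : ∀ c, 0 ≤ v c) (hprec : IsUniversalOrdering v prec)
    (hpos : 0 < v c) {t t' : ChoreTuple C} (h : Admissible v τ μ c t)
    (ht : TidyUp prec v c t t') :
    (∃ μ₀ ≤ μ, ∃ P, IsTidied prec v τ μ₀ c t' P) ∧ t'.bundles.length ≤ t.bundles.length ∧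
      excess v τ t'.bundles ≤ excess v τ t.bundles := by
  obtain ⟨P, s, hlen, hP, hle, hs, hd, rfl⟩ := ht
  have h1 := ((h.tidying hlen hP hle).tidy hv hprec hpos).reflTransGen hv hs
  have h2 := sublist_of_reflTransGen hs
  refine ⟨⟨_, h.mms_le, s.parts, { h1 with undominated := ?_ }⟩, ?_, ?_⟩
  · exact fun A hA Q hQ hdom => hd ⟨A, hA, Q, hQ, hdom⟩
  · simpa [TidyState.removeRedundant, TidyState.removeSmaller, TidyState.removeUnallocated,
      TidyState.remove] using h2.length_le
  · exact (h2.countP_le).trans ((excess_map_sdiff_le hv _ _).trans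
      ((excess_map_sdiff_le hv _ _).trans (excess_map_sdiff_le hv _ _)))

lemma IsTidied.admissible (hv : ∀ c, 0 ≤ v c) {t : ChoreTuple C} {P : List (Finset C)}
    {μ₀ : ℝ} (h : IsTidied prec v τ μ₀ c t P) (hμ : μ₀ ≤ μ) : Admissible v τ μ c t where
  collection := h.collection
  firstFit := h.firstFit
  mem := h.mem
  unalloc := h.unalloc
  -- The chore `c` lies in some part, and there are as many bundles as parts, so Tidy-Up cannot
  -- delete all bundles.
  length_pos := by
    have h1 := h.mem
    rw [← h.complete.covers] at h1
    obtain ⟨Q, hQ, -⟩ := mem_allocated.1 h1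
    have h2 : P.length = t.bundles.length := h.length_eq
    rw [← h2]
    exact List.length_pos_of_mem hQ
  mms_le := by
    have h1 := h.mem
    rw [← h.complete.covers] at h1
    obtain ⟨Q, hQ, -⟩ := mem_allocated.1 h1
    have h2 : P.length = t.bundles.length := h.length_eq
    rw [← h2]
    exact mms_le h.complete (((cost_nonneg hv Q).trans (h.parts_le Q hQ)).trans hμ)
      fun Q hQ => (h.parts_le Q hQ).trans hμ

/-! ### Replacing an excessive chore -/

lemma cost_replaceChore_le (hv : ∀ c, 0 ≤ v c) {S : Finset C} {ck c₀ : C} (hck : ck ∈ S)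
    (hlt : v c₀ ≤ v ck) : cost v (replaceChore S ck c₀) ≤ cost v S := by
  have h1 := cost_union_le hv {c₀} (S.erase ck)
  have h2 := cost_erase (v := v) hck
  rw [replaceChore, Finset.insert_eq]
  have h3 : cost v {c₀} = v c₀ := by simp [cost]
  linarith

lemma mem_replaceChore {S : Finset C} {ck c₀ x : C} :
    x ∈ replaceChore S ck c₀ ↔ x = c₀ ∨ x ≠ ck ∧ x ∈ S := by
  simp [replaceChore]

/-- Swapping the chore inside an optimal partition does not raise the cost of any part. -/
lemma mms_replaceChore_le (hv : ∀ c, 0 ≤ v c) {M : Finset C} {n : ℕ} (hn : 1 ≤ n) {ck c₀ : C}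
    (hck : ck ∈ M) (hc₀ : c₀ ∉ M) (hlt : v c₀ ≤ v ck) :
    mms v (replaceChore M ck c₀) n ≤ mms v M n := by
  obtain ⟨P, rfl, hP, hle⟩ := exists_partition v M hn
  let g : Finset C → Finset C := fun Q => if ck ∈ Q then replaceChore Q ck c₀ else Q
  have hg : ∀ Q ∈ P, ∀ x, x ∈ g Q ↔ (x = c₀ ∧ ck ∈ Q) ∨ (x ≠ c₀ ∧ x ≠ ck ∧ x ∈ Q) := by
    intro Q hQ x
    have hQc : c₀ ∉ Q := fun h => hc₀ (hP.subset Q hQ h)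
    simp only [g]
    split_ifs with h
    · rw [mem_replaceChore]
      by_cases hx : x = c₀ <;> simp [hx, h]
    · constructor
      · exact fun hx => Or.inr ⟨fun h' => hQc (h' ▸ hx), fun h' => h (h' ▸ hx), hx⟩
      · rintro (h' | h')
        · exact absurd h'.2 h
        · exact h'.2.2
  have hcomp : IsComplete (replaceChore M ck c₀) (P.map g) := by
    refine { subset := ?_, disjoint := ?_, covers := ?_ }
    · intro Q' hQ' x hx
      obtain ⟨Q, hQ, rfl⟩ := List.mem_map.1 hQ'
      rw [mem_replaceChore]
      rcases (hg Q hQ x).1 hx with h | h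
      · exact Or.inl h.1
      · exact Or.inr ⟨h.2.1, hP.subset Q hQ h.2.2⟩
    · rw [List.pairwise_map]
      refine hP.disjoint.imp_of_mem fun {Q Q'} hQ hQ' hd => ?_
      rw [Finset.disjoint_left] at hd ⊢
      intro x hx hx'
      rw [hg Q hQ] at hx
      rw [hg Q' hQ'] at hx'
      rcases hx with hx | hx <;> rcases hx' with hx' | hx'
      · exact hd hx.2 hx'.2
      · exact hx'.1 hx.1
      · exact hx.1 hx'.1
      · exact hd hx.2.2 hx'.2.2
    · ext x
      rw [mem_allocated, mem_replaceChore]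
      constructor
      · rintro ⟨Q', hQ', hx⟩
        obtain ⟨Q, hQ, rfl⟩ := List.mem_map.1 hQ'
        rcases (hg Q hQ x).1 hx with h | h
        · exact Or.inl h.1
        · exact Or.inr ⟨h.2.1, hP.subset Q hQ h.2.2⟩
      · rintro (rfl | ⟨hx, hxM⟩)
        · rw [← hP.covers, mem_allocated] at hck
          obtain ⟨Q, hQ, hck⟩ := hck
          exact ⟨g Q, List.mem_map_of_mem hQ, (hg Q hQ _).2 (Or.inl ⟨rfl, hck⟩)⟩
        · have hxc : x ≠ c₀ := fun h => hc₀ (h ▸ hxM)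
          rw [← hP.covers, mem_allocated] at hxM
          obtain ⟨Q, hQ, hxQ⟩ := hxM
          exact ⟨g Q, List.mem_map_of_mem hQ, (hg Q hQ _).2 (Or.inr ⟨hxc, hx, hxQ⟩)⟩
  have := mms_le hcomp (mms_nonneg v M P.length) (fun Q' hQ' => by
    obtain ⟨Q, hQ, rfl⟩ := List.mem_map.1 hQ'
    refine le_trans ?_ (hle Q hQ)
    simp only [g]
    split_ifs with h
    · exact cost_replaceChore_le hv h hlt
    · exact le_rfl)
  simpa using this

lemma excess_append (l l' : List (Finset C)) :
    excess v τ (l ++ l') = excess v τ l + excess v τ l' := List.countP_append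

lemma excess_eq_zero {l : List (Finset C)} (h : ∀ B ∈ l, cost v B ≤ τ) : excess v τ l = 0 := by
  rw [excess, List.countP_eq_zero]
  intro B hB
  simpa using h B hB

/-- The new initial bundles are FFD bins, hence first fit and of cost at most `τ`. By the condition
on their union, the later bundles see only chores that were available before. -/
lemma Admissible.replaceStep (hv : ∀ c, 0 ≤ v c) (hτ : 0 ≤ τ) {t t' : ChoreTuple C}
    (h : Admissible v τ μ c t) (ht : ReplaceStep prec v τ t t') :
    Admissible v τ μ c t' ∧ t'.bundles.length = t.bundles.length ∧
      excess v τ t'.bundles < excess v τ t.bundles := by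
  obtain ⟨k, A, ck, c₀, D, hk, hexc, -, ⟨hfresh, hsmall, hD, hunion⟩, rfl⟩ := ht
  have hklt := (List.getElem?_eq_some_iff.1 hk).1
  have hDlen := hD.length_eq
  have hDg := hD.greedy hv hτ
  have hsplit := List.take_append_drop (k + 1) t.bundles
  have hDg' : Greedy v τ (D.take (k + 1)) (replaceChore t.items ck c₀) := by
    rw [← List.take_append_drop (k + 1) D, greedy_append] at hDg
    exact hDg.1
  have hckalloc : ck ∈ allocated (t.bundles.take (k + 1)) := by
    refine mem_allocated.2 ⟨A, ?_, hexc.2.1⟩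
    exact List.mem_of_getElem? (i := k) (by rw [List.getElem?_take_of_lt (by omega), hk])
  have htakesub : allocated (t.bundles.take (k + 1)) ⊆ t.items := by
    intro x hx
    obtain ⟨B, hB, hx⟩ := mem_allocated.1 hx
    exact h.collection.subset B (List.mem_of_mem_take hB) hx
  have hcne : c ≠ ck := by
    rintro rfl
    refine h.unalloc ?_
    rw [← hsplit, allocated_append]
    exact Finset.mem_union_left _ hckalloc
  have hpw := h.collection.disjoint
  rw [← hsplit, List.pairwise_append] at hpw
  have hdrop : ∀ B ∈ t.bundles.drop (k + 1), ∀ x ∈ B,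
      x ∈ t.items ∧ x ∉ allocated (t.bundles.take (k + 1)) := by
    intro B hB x hx
    refine ⟨h.collection.subset B (List.mem_of_mem_drop hB) hx, fun hx' => ?_⟩
    obtain ⟨B', hB', hx'⟩ := mem_allocated.1 hx'
    exact Finset.disjoint_left.1 (hpw.2.2 B' hB' B hB) hx' hx
  have hlen : (D.take (k + 1) ++ t.bundles.drop (k + 1)).length = t.bundles.length := by
    simp; omega
  refine ⟨⟨⟨?_, ?_⟩, ?_, ?_, ?_, ?_, ?_⟩, hlen, ?_⟩
  · intro B hB x hx
    rcases List.mem_append.1 hB with hB | hB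
    · exact hDg'.subset B hB hx
    · obtain ⟨h1, h2⟩ := hdrop B hB x hx
      rw [mem_replaceChore]
      exact Or.inr ⟨fun hxc => h2 (hxc ▸ hckalloc), h1⟩
  · refine List.pairwise_append.2 ⟨hDg'.pairwise, hpw.2.1, fun B hB B' hB' => ?_⟩
    rw [Finset.disjoint_left]
    intro x hx hx'
    have h1 : x ∈ allocated (D.take (k + 1)) := mem_allocated.2 ⟨B, hB, hx⟩
    obtain ⟨h2, h3⟩ := hdrop B' hB' x hx'
    rw [hunion, mem_replaceChore] at h1
    rcases h1 with rfl | h1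
    · exact hfresh h2
    · exact h3 h1.2
  · refine firstFit_append.2 ⟨hDg'.firstFit, ?_⟩
    have h1 := h.firstFit
    rw [← hsplit, firstFit_append] at h1
    refine h1.2.mono fun x hx => ?_
    simp only [hunion, Finset.mem_sdiff, mem_replaceChore] at hx ⊢
    tauto
  · rw [mem_replaceChore]
    exact Or.inr ⟨hcne, h.mem⟩
  · rw [allocated_append, Finset.mem_union, hunion, mem_replaceChore]
    rintro ((rfl | hx) | hx)
    · exact hfresh h.mem
    · refine h.unalloc ?_
      rw [← hsplit, allocated_append]
      exact Finset.mem_union_left _ hx.2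
    · refine h.unalloc ?_
      rw [← hsplit, allocated_append]
      exact Finset.mem_union_right _ hx
  · rw [hlen]; exact h.length_pos
  · rw [hlen]
    exact (mms_replaceChore_le hv h.length_pos (htakesub hckalloc) hfresh hsmall.le).trans h.mms_le
  -- The initial segment contained the excessive bundle `A` and now contains none, so the count
  -- drops strictly.
  · have h1 : 0 < excess v τ (t.bundles.take (k + 1)) := by
      rw [excess, List.countP_pos_iff]
      refine ⟨A, List.mem_of_getElem? (i := k) ?_, by simpa using hexc.1⟩
      rw [List.getElem?_take_of_lt (by omega), hk]
    conv_rhs => rw [← hsplit]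
    rw [excess_append, excess_append, excess_eq_zero hDg'.cost_le]
    omega

/-! ### Greedy lists after a replacement -/

lemma Greedy.insert_of_not_fit {l : List (Finset C)} {S : Finset C} (h : Greedy v τ l S)
    {c₀ : C} (hc₀ : c₀ ∉ S)
    (hfit : ∀ B ∈ l, τ < cost v (atLeast v B (v c₀)) + v c₀) : Greedy v τ l (insert c₀ S) := by
  induction l generalizing S with
  | nil => trivial
  | cons B l ih =>
    refine ⟨⟨h.1.1.trans (Finset.subset_insert _ _), h.1.2.1, fun x hx hxB => ?_⟩, ?_⟩
    · rcases Finset.mem_insert.1 hx with rfl | hx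
      · exact hfit B (by simp)
      · exact h.1.2.2 x hx hxB
    · rw [Finset.insert_sdiff_of_notMem _ fun h' => hc₀ (h.1.1 h')]
      exact ih h.2 (fun h' => hc₀ (Finset.mem_sdiff.1 h').1) fun B' hB' => hfit B' (by simp [hB'])

/-- FFD can put a free chore into its first bin, where it affects neither the cost nor the tests for
other chores. -/
lemma Greedy.insert_head (hv : ∀ c, 0 ≤ v c) {B : Finset C} {l : List (Finset C)} {S : Finset C}
    (h : Greedy v τ (B :: l) S) {c₀ : C} (hc₀ : c₀ ∉ S) (hzero : v c₀ = 0) :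
    Greedy v τ (insert c₀ B :: l) (insert c₀ S) := by
  have hB : c₀ ∉ B := fun h' => hc₀ (h.1.1 h')
  refine ⟨⟨Finset.insert_subset_insert _ h.1.1, ?_, fun x hx hxB => ?_⟩, ?_⟩
  · rw [cost_insert hB, hzero, add_zero]
    exact h.1.2.1
  · rw [Finset.mem_insert, not_or] at hxB
    refine (h.1.2.2 x (Finset.mem_of_mem_insert_of_ne hx hxB.1) hxB.2).trans_le ?_
    gcongr
    refine cost_mono hv fun y hy => ?_
    rw [mem_atLeast] at hy ⊢
    exact ⟨Finset.mem_insert_of_mem hy.1, hy.2⟩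
  · convert h.2 using 1
    ext x
    simp only [Finset.mem_sdiff, Finset.mem_insert, not_or]
    constructor
    · rintro ⟨rfl | h1, h2, h3⟩
      · exact absurd rfl h2
      · exact ⟨h1, h3⟩
    · rintro ⟨h1, h2⟩
      exact ⟨Or.inr h1, fun h3 => hc₀ (h3 ▸ h1), h2⟩

/-- If `y` costs at most `v ck`, all of `A.erase ck` counts in the test for `y`; if it costs more,
`ck` never counted. -/
lemma lt_cost_atLeast_erase {A T : Finset C} (hA : Packed v τ A T) {ck y : C}
    (hck : ∀ x ∈ A, v ck ≤ v x) (hy : y ∈ T) (hyA : y ∉ A) (hpos : 0 < v y)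
    (hlt : τ < cost v (A.erase ck) + v y) :
    τ < cost v (atLeast v (A.erase ck) (v y)) + v y := by
  rcases le_or_gt (v y) (v ck) with h | h
  · rwa [atLeast_eq_self fun x hx => h.trans (hck x (Finset.mem_of_mem_erase hx))]
  · convert hA y hy hyA hpos using 3
    ext x
    simp only [mem_atLeast, Finset.mem_erase]
    constructor
    · exact fun hx => ⟨hx.1.2, hx.2⟩
    · exact fun hx => ⟨⟨fun hxc => absurd hx.2 (not_le.2 (hxc ▸ h)), hx.1⟩, hx.2⟩

/-! ### Domination of small parts -/

lemma dominates_of_subset (hv : ∀ c, 0 ≤ v c) {A Q : Finset C} (h : Q ⊆ A) :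
    Dominates v A Q := by
  refine ⟨id, fun x hx => h hx, fun x _ => ?_⟩
  have : Q.filter (fun y => id y = x) ⊆ {x} := fun y hy => by simpa using (Finset.mem_filter.1 hy).2
  exact (cost_mono hv this).trans (by simp [cost])

/-- The map sends `x` to itself and the rest of `Q` to `z`. It is not assumed that `x` lies in `Q`.
-/
lemma dominates_of_cost_erase_le (hv : ∀ c, 0 ≤ v c) {A Q : Finset C} {x z : C} (hx : x ∈ A)
    (hz : z ∈ A) (hne : z ≠ x) (hle : cost v (Q.erase x) ≤ v z) : Dominates v A Q := by
  refine ⟨fun y => if y = x then x else z, fun y _ => ?_, fun w _ => ?_⟩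
  · dsimp only
    split_ifs
    · exact hx
    · exact hz
  · by_cases hwx : w = x
    · have : Q.filter (fun y => (if y = x then x else z) = w) ⊆ {w} := by
        intro y hy
        have h1 := (Finset.mem_filter.1 hy).2
        rw [Finset.mem_singleton]
        split_ifs at h1 with h2
        · exact h2.trans h1
        · exact absurd (h1.trans hwx) hne
      exact (cost_mono hv this).trans (by simp [cost])
    · by_cases hwz : w = z
      · rw [hwz]
        refine (cost_mono hv fun y hy => ?_).trans hle
        obtain ⟨h0, h1⟩ := Finset.mem_filter.1 hy
        refine Finset.mem_erase.2 ⟨fun h2 => hne ?_, h0⟩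
        simp only [if_pos h2] at h1
        exact h1.symm
      · rw [Finset.filter_false_of_mem]
        · simpa [cost] using hv w
        · intro y _
          dsimp only
          split_ifs
          · exact fun h => hwx h.symm
          · exact fun h => hwz h.symm

/-- The first bundle `B` that meets `Q`, say in `x`, dominates it. If the other chore `y` is not in
`B`, it was available and did not fit; as `v x + v y ≤ τ`, `B` has a chore other than `x` that is at
least as large as `y`, and `y` is mapped there. -/
lemma exists_dominates_of_card_le_two (hv : ∀ c, 0 ≤ v c) {l : List (Finset C)} {S Q : Finset C}
    (h : FirstFit v τ l S) (hQ : Q ⊆ S) (hcard : Q.card ≤ 2) (hcost : cost v Q ≤ τ)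
    (hpos : ∀ x ∈ Q, 0 < v x) {b : C} (hb : b ∈ Q) (hbl : b ∈ allocated l) :
    ∃ B ∈ l, Dominates v B Q := by
  induction l generalizing S with
  | nil => simp at hbl
  | cons B l ih =>
    by_cases hdisj : Disjoint Q B
    · have hbB := Finset.disjoint_left.1 hdisj hb
      rw [allocated_cons, Finset.mem_union, or_iff_right hbB] at hbl
      obtain ⟨B', hB', hd⟩ := ih h.2
        (fun x hx => Finset.mem_sdiff.2 ⟨hQ hx, Finset.disjoint_left.1 hdisj hx⟩) hbl
      exact ⟨B', by simp [hB'], hd⟩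
    · refine ⟨B, by simp, ?_⟩
      rw [Finset.not_disjoint_iff] at hdisj
      obtain ⟨x, hxQ, hxB⟩ := hdisj
      by_cases hsub : Q ⊆ B
      · exact dominates_of_subset hv hsub
      · obtain ⟨y, hyQ, hyB⟩ := Finset.not_subset.1 hsub
        have hxy : y ≠ x := fun h' => hyB (h' ▸ hxB)
        have herase : Q.erase x = {y} := by
          refine (Finset.eq_of_subset_of_card_le (Finset.singleton_subset_iff.2
            (Finset.mem_erase.2 ⟨hxy, hyQ⟩)) ?_).symm
          rw [Finset.card_erase_of_mem hxQ, Finset.card_singleton]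
          omega
        have h1 := h.1 y (hQ hyQ) hyB (hpos y hyQ)
        have h2 := cost_erase (v := v) hxQ
        have hy : cost v {y} = v y := by simp [cost]
        have hx : cost v {x} = v x := by simp [cost]
        by_cases hz : ∃ z ∈ atLeast v B (v y), z ≠ x
        · obtain ⟨z, hz, hzx⟩ := hz
          rw [mem_atLeast] at hz
          exact dominates_of_cost_erase_le hv hxB hz.1 hzx (by rw [herase, hy]; exact hz.2)
        · push Not at hz
          have h3 : atLeast v B (v y) ⊆ {x} := fun z hz' => by simpa using hz z hz'
          have h4 := cost_mono hv h3
          rw [herase] at h2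
          linarith

/-! ### Existence of a suitable reduced chore -/

lemma exists_first_split {β : Type*} (p : β → Prop) (l : List β) :
    (∀ B ∈ l, ¬ p B) ∨ ∃ l₁ B l₂, l = l₁ ++ B :: l₂ ∧ (∀ B' ∈ l₁, ¬ p B') ∧ p B := by
  induction l with
  | nil => simp
  | cons B l ih =>
    by_cases hB : p B
    · exact Or.inr ⟨[], B, l, rfl, by simp, hB⟩
    · rcases ih with ih | ⟨l₁, B', l₂, rfl, h1, h2⟩
      · exact Or.inl (by simpa [hB] using ih)
      · exact Or.inr ⟨B :: l₁, B', l₂, rfl, by simpa [hB] using h1, h2⟩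

/-- If a chore of cost `ρ` fits into a bundle `B` that was packed while two chores `e₁`, `e₂` that
leave the room `ρ` were available, then no chore that was available then is larger than `e₂`. -/
lemma le_of_room_fits (hv : ∀ c, 0 ≤ v c) {B T : Finset C} {e₁ e₂ d : C} {s ρ : ℝ}
    (hB : Packed v τ B T) (hs : τ < 8 * s) (hμ : 8 * μ ≤ 7 * τ) (hμ0 : 0 < μ)
    (hTμ : ∀ y ∈ T, v y ≤ μ) (hBμ : ∀ y ∈ B, v y ≤ μ - 2 * s)
    (he₁ : e₁ ∈ T) (he₂ : e₂ ∈ T) (hd : d ∈ T) (he₁B : e₁ ∉ B) (he₂B : e₂ ∉ B) (hdB : d ∉ B)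
    (h12 : v e₂ ≤ v e₁) (h2d : v d ≤ v e₂) (hdρ : ρ < v d) (hρ : 2 * s ≤ ρ)
    (hsum : v e₁ + v e₂ + ρ = τ) (hfit : cost v (atLeast v B ρ) + ρ ≤ τ) :
    ∀ y ∈ T, v y ≤ v e₂ := by
  have hsub : ∀ w, ρ ≤ w → atLeast v B w ⊆ atLeast v B ρ := fun w hw x hx =>
    mem_atLeast.2 ⟨(mem_atLeast.1 hx).1, hw.trans (mem_atLeast.1 hx).2⟩
  have hs0 : 0 < s := by linarith only [hs, hμ, hμ0]
  have hpos : ∀ y, ρ < v y → 0 < v y := fun y hy => by linarith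
  have p1 := hB e₁ he₁ he₁B (hpos _ (by linarith))
  have p2 := hB e₂ he₂ he₂B (hpos _ (by linarith))
  have pd := hB d hd hdB (hpos _ hdρ)
  -- Otherwise `e₁` alone would exceed `τ`, although it costs at most `μ`.
  have hne : (atLeast v B (v e₁)).Nonempty := by
    rw [Finset.nonempty_iff_ne_empty]
    intro h0
    rw [h0, cost, Finset.sum_empty] at p1
    linarith [hTμ e₁ he₁]
  obtain ⟨b₁, hb₁⟩ := hne
  have hb₁H := hsub _ (by linarith) hb₁
  rw [mem_atLeast] at hb₁
  -- Three such chores and the new one would cost at least `3 * 2s + 2s = 8s > τ`.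
  have hcard : (atLeast v B ρ).card ≤ 2 := by
    by_contra! h3
    have h1 : (atLeast v B ρ).card • (2 * s) ≤ cost v (atLeast v B ρ) :=
      Finset.card_nsmul_le_sum _ _ _ fun x hx => hρ.trans (mem_atLeast.1 hx).2
    have h4 : (3 : ℝ) ≤ (atLeast v B ρ).card := by exact_mod_cast h3
    rw [nsmul_eq_mul] at h1
    have h5 := mul_le_mul_of_nonneg_right h4 (by linarith : 0 ≤ 2 * s)
    linarith
  have hb₁μ := hBμ b₁ hb₁.1
  have hsplit := cost_erase (v := v) hb₁H
  have hone : ∀ w, ρ ≤ w → atLeast v B w ⊆ {b₁} → cost v (atLeast v B w) ≤ v b₁ :=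
    fun w _ h => (cost_mono hv h).trans (by simp [cost])
  -- If `b₁` were alone, packing would give `τ < v b₁ + v d`. But `v b₁ ≤ μ - 2s ≤ 7τ/8 - 2s` and `v
  -- d ≤ (τ - ρ)/2 ≤ τ/2 - s`, which add up to less than `τ` because `8s > τ`.
  rcases Finset.eq_empty_or_nonempty ((atLeast v B ρ).erase b₁) with h0 | ⟨b₂, hb₂⟩
  · exfalso
    have h1 : atLeast v B (v d) ⊆ {b₁} := fun x hx => by
      by_contra hxb
      have : x ∈ (atLeast v B ρ).erase b₁ :=
        Finset.mem_erase.2 ⟨by simpa using hxb, hsub _ hdρ.le hx⟩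
      simp [h0] at this
    linarith [hone _ hdρ.le h1]
  have hH : ∀ x ∈ atLeast v B ρ, x = b₁ ∨ x = b₂ := by
    intro x hx
    by_contra! hcon
    have h3 : ({b₂, x} : Finset C) ⊆ (atLeast v B ρ).erase b₁ := by
      intro y hy
      rcases Finset.mem_insert.1 hy with rfl | hy
      · exact hb₂
      · rw [Finset.mem_singleton.1 hy]
        exact Finset.mem_erase.2 ⟨hcon.1, hx⟩
    have h4 := Finset.card_le_card h3
    rw [Finset.card_pair hcon.2.symm, Finset.card_erase_of_mem hb₁H] at h4
    omega
  have hb₂' := Finset.mem_erase.1 hb₂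
  have hcost : v b₁ + v b₂ ≤ v e₁ + v e₂ := by
    have h1 : cost v {b₂} ≤ cost v ((atLeast v B ρ).erase b₁) :=
      cost_mono hv (Finset.singleton_subset_iff.2 hb₂)
    have h2 : cost v {b₂} = v b₂ := by simp [cost]
    linarith
  -- Same estimate with `e₂` in place of `d`, since also `v e₂ ≤ (τ - ρ)/2`.
  have hb₂ge : v e₂ ≤ v b₂ := by
    by_contra! hlt
    have h1 : atLeast v B (v e₂) ⊆ {b₁} := fun x hx => by
      rcases hH x (hsub _ (by linarith) hx) with rfl | rfl
      · simp
      · exact absurd (mem_atLeast.1 hx).2 (not_le.2 hlt)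
    linarith [hone _ (by linarith) h1]
  -- If `v e₂ < v e₁`, then `v b₂ ≤ v e₂ < v e₁`, so only `b₁` counts for `e₁` and `τ < v b₁ + v e₁
  -- ≤ 2 * v e₁`. But `v e₁ = τ - ρ - v e₂ < τ - 4s < τ/2`.
  have heq : v e₁ = v e₂ := by
    by_contra hne
    have hlt : v e₂ < v e₁ := lt_of_le_of_ne h12 (Ne.symm hne)
    have h1 : atLeast v B (v e₁) ⊆ {b₁} := fun x hx => by
      rcases hH x (hsub _ (by linarith) hx) with rfl | rfl
      · simp
      · linarith [(mem_atLeast.1 hx).2]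
    linarith [hone _ (by linarith) h1]
  -- Now `b₁`, `b₂`, `e₁`, `e₂` all have the same cost. A larger available `y` would find no chore
  -- of `B` of its size, so it would either be missing from `B` with `τ < v y ≤ μ`, or be such a
  -- chore itself.
  intro y hy
  by_contra! hlt
  have hyH : ∀ x ∈ atLeast v B (v y), False := fun x hx => by
    have h1 := (mem_atLeast.1 hx).2
    rcases hH x (hsub _ (by linarith) hx) with rfl | rfl <;> linarith [hb₁.2]
  by_cases hyB : y ∈ B
  · exact hyH y (mem_atLeast.2 ⟨hyB, le_rfl⟩)
  · have h1 := hB y hy hyB (hpos y (by linarith))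
    rw [Finset.eq_empty_of_forall_notMem hyH, cost, Finset.sum_empty] at h1
    linarith [hTμ y hy]

/-- New chores of every cost are available without limit. -/
def Supply (v : C → ℝ) : Prop := ∀ (M : Finset C) (x : ℝ), 0 ≤ x → ∃ c₀, c₀ ∉ M ∧ v c₀ = x

/-- Only the first bins matter: filling the remaining ones greedily turns `D` into a full FFD output
whose initial segment is `D`. -/
lemma exists_replaceStep_of_greedy (hv : ∀ c, 0 ≤ v c) (hτ : 0 ≤ τ) {t : ChoreTuple C}
    {l l' : List (Finset C)} {A : Finset C} (ht : t.bundles = l ++ A :: l')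
    (hl : ∀ B ∈ l, cost v B ≤ τ) {ck c₀ : C} (hA : IsExcessive prec v τ A ck)
    (hc₀ : c₀ ∉ t.items) (hlt : v c₀ < v ck) {D : List (Finset C)} (hlen : D.length = l.length + 1)
    (hD : Greedy v τ D (replaceChore t.items ck c₀))
    (hunion : allocated D = replaceChore (allocated (l ++ [A])) ck c₀) :
    ∃ t', ReplaceStep prec v τ t t' := by
  obtain ⟨D', hlen', hD'⟩ := exists_greedy hv hτ
    (replaceChore t.items ck c₀ \ allocated D) l'.length
  have hfull : Greedy v τ (D ++ D') (replaceChore t.items ck c₀) := greedy_append.2 ⟨hD, hD'⟩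
  have h1 := hfull.isFFDOutput hv
  have h2 : (D ++ D').length = t.bundles.length := by simp [ht, hlen, hlen']; omega
  rw [h2] at h1
  refine ⟨_, l.length, A, ck, c₀, D ++ D', by simp [ht], hA, ?_, ⟨hc₀, hlt, h1, ?_⟩, rfl⟩
  · intro B hB
    rw [ht, List.take_left] at hB
    rintro ⟨_, h3, -⟩
    linarith [hl B hB]
  · have h3 : (D ++ D').take (l.length + 1) = D := by rw [← hlen, List.take_left]
    have h4 : t.bundles.take (l.length + 1) = l ++ [A] := by
      rw [ht, show l ++ A :: l' = (l ++ [A]) ++ l' by simp]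
      exact List.take_left' (by simp)
    rw [h3, h4, hunion]

lemma exists_isLastChore (hprec : IsUniversalOrdering v prec) (hτ : 0 ≤ τ) {A : Finset C}
    (hA : τ < cost v A) : ∃ ck, IsLastChore prec A ck := by
  have hAne : A.Nonempty := by
    rw [Finset.nonempty_iff_ne_empty]
    rintro rfl
    simp only [cost, Finset.sum_empty] at hA
    linarith
  obtain ⟨ck, h1, h2⟩ := exists_first_of_nonempty (r := fun a b => prec b a) hprec.irrefl
    (fun a b c hab hbc => hprec.trans _ _ _ hbc hab) hAne
  exact ⟨ck, h1, fun x hx hne => (hprec.total x ck hne).resolve_right (h2 x hx)⟩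

lemma IsTidied.exists_replaceStep (hv : ∀ c, 0 ≤ v c) (hprec : IsUniversalOrdering v prec)
    (hsupply : Supply v) (hpos : 0 < v c) (hμτ : 8 * μ ≤ 7 * τ) {t : ChoreTuple C}
    {P : List (Finset C)} (h : IsTidied prec v τ μ c t P) (hex : HasExcessive prec v τ t) :
    ∃ t', ReplaceStep prec v τ t t' := by
  have hpart : ∀ x ∈ t.items, ∃ Q ∈ P, x ∈ Q := fun x hx => by
    have h1 : allocated P = t.items := h.complete.covers
    exact mem_allocated.1 (h1 ▸ hx)
  have hxμ : ∀ x ∈ t.items, v x ≤ μ := fun x hx => by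
    obtain ⟨Q, hQ, hxQ⟩ := hpart x hx
    have h1 := cost_mono hv (Finset.singleton_subset_iff.2 hxQ)
    have h2 : cost v {x} = v x := by simp [cost]
    linarith [h.parts_le Q hQ]
  have hge : ∀ x ∈ t.items, v c ≤ v x := h.ge
  have hposI : ∀ x ∈ t.items, 0 < v x := fun x hx => hpos.trans_le (hge x hx)
  have hμ0 : 0 < μ := hpos.trans_le (hxμ c h.mem)
  have hτ : 0 ≤ τ := by linarith
  -- This is where `8/7` enters: `v c > τ - μ ≥ τ/8`, and every remaining chore costs at least `v
  -- c`.
  have h8 : τ < 8 * v c := by linarith [h.toTidying.lt_add hv hpos]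
  obtain ⟨l, A, l', ht, hl, hA⟩ : ∃ l A l', t.bundles = l ++ A :: l' ∧
      (∀ B ∈ l, ¬ τ < cost v B) ∧ τ < cost v A := by
    rcases exists_first_split (fun B => τ < cost v B) t.bundles with h1 | h1
    · obtain ⟨B, hB, _, h2, -⟩ := hex
      exact absurd h2 (h1 B hB)
    · exact h1
  simp only [not_lt] at hl
  obtain ⟨ck, hckA, hcklast⟩ := exists_isLastChore hprec hτ hA
  have hcoll : IsBundleCollection t.items (l ++ A :: l') := ht ▸ h.collection
  have hff : FirstFit v τ (l ++ A :: l') t.items := ht ▸ h.firstFit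
  have hAmem : A ∈ t.bundles := by simp [ht]
  have hsub : ∀ B ∈ l ++ A :: l', B ⊆ t.items := hcoll.subset
  have hpw := List.pairwise_append.1 hcoll.disjoint
  have hAI : A ⊆ t.items := hsub A (by simp)
  set E := A.erase ck with hE
  have hcA : cost v E + v ck = cost v A := cost_erase hckA
  -- The last chore `ck` is not redundant, and `E` is everything before it.
  have hcE : cost v E < μ := by
    have h1 := h.nonredundant A hAmem ck hckA
    have h2 : A.filter (fun y => prec y ck) = E := by
      ext x
      rw [Finset.mem_filter, hE, Finset.mem_erase]
      constructor
      · exact fun hx => ⟨fun hxc => hprec.irrefl ck (hxc ▸ hx.2), hx.1⟩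
      · exact fun hx => ⟨hx.2, hcklast x hx.2 hx.1⟩
    rwa [h2] at h1
  have hckle : ∀ x ∈ A, v ck ≤ v x := fun x hx => by
    by_cases hxc : x = ck
    · rw [hxc]
    · exact le_of_prec hprec (hcklast x hx hxc)
  set T := t.items \ allocated l with hT
  have hlA : ∀ x ∈ A, x ∉ allocated l := fun x hx hx' => by
    obtain ⟨B, hB, hxB⟩ := mem_allocated.1 hx'
    exact Finset.disjoint_left.1 (hpw.2.2 B hB A (by simp)) hxB hx
  have hAT : A ⊆ T := fun x hx => Finset.mem_sdiff.2 ⟨hAI hx, hlA x hx⟩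
  have hck_l : ck ∉ allocated l := hlA ck hckA
  have hckE : ck ∉ E := Finset.notMem_erase ck A
  have hET : E ⊆ T.erase ck := fun x hx => Finset.mem_erase.2
    ⟨(Finset.mem_erase.1 hx).1, hAT (Finset.mem_erase.1 hx).2⟩
  have hTE : t.items.erase ck \ allocated l = T.erase ck := by
    ext x; simp only [Finset.mem_sdiff, Finset.mem_erase, hT]; tauto
  obtain ⟨hff₁, hff₂⟩ := firstFit_append.1 hff
  have hPA : Packed v τ A T := hff₂.1
  have hgl : Greedy v τ l (t.items.erase ck) := by
    refine (hff₁.greedy hposI (fun B hB => hsub B (by simp [hB])) hpw.1 hl).mono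
      (Finset.erase_subset _ _) fun B hB x hx => Finset.mem_erase.2 ⟨?_, hsub B (by simp [hB]) hx⟩
    rintro rfl
    exact hck_l (mem_allocated.2 ⟨B, hB, hx⟩)
  have halloc : ∀ c₀, replaceChore (allocated (l ++ [A])) ck c₀ = insert c₀ (allocated l ∪ E) := by
    intro c₀
    ext x
    simp only [mem_replaceChore, allocated_append, allocated_cons, allocated_nil,
      Finset.mem_union, Finset.mem_insert, Finset.union_empty, hE, Finset.mem_erase]
    constructor
    · tauto
    · rintro (hx | hx | hx)
      · exact Or.inl hx
      · exact Or.inr ⟨fun hxc => hck_l (hxc ▸ hx), Or.inl hx⟩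
      · exact Or.inr ⟨hx.1, Or.inr hx.2⟩
  have herase : ∀ y ∈ T.erase ck, y ∉ E → τ < cost v E + v y →
      τ < cost v (atLeast v E (v y)) + v y := by
    intro y hy hyE hlt
    rw [Finset.mem_erase] at hy
    exact lt_cost_atLeast_erase hPA hckle hy.2 (fun hyA => hyE (Finset.mem_erase.2 ⟨hy.1, hyA⟩))
      (hposI y (Finset.mem_sdiff.1 hy.2).1) hlt
  by_cases hnone : ∀ y ∈ T.erase ck, y ∉ E → τ < cost v E + v y
  · -- no available chore fits after `E`
    -- A free chore joins the first bin, and `l` followed by `E` is already greedy without `ck`.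
    obtain ⟨c₀, hc₀, hv₀⟩ := hsupply t.items 0 le_rfl
    have hg : Greedy v τ (l ++ [E]) (t.items.erase ck) := by
      refine greedy_append.2 ⟨hgl, ⟨?_, trivial⟩⟩
      rw [hTE]
      exact ⟨hET, by linarith, fun y hy hyE => herase y hy hyE (hnone y hy hyE)⟩
    have hc₀' : c₀ ∉ t.items.erase ck := fun hx => hc₀ (Finset.mem_of_mem_erase hx)
    have hex : ∀ l₀ : List (Finset C), l₀ ≠ [] → Greedy v τ l₀ (t.items.erase ck) →
        ∃ D : List (Finset C), D.length = l₀.length ∧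
          Greedy v τ D (insert c₀ (t.items.erase ck)) ∧
          allocated D = insert c₀ (allocated l₀) := by
      rintro (_ | ⟨B, l₀⟩) hne hg
      · exact absurd rfl hne
      · exact ⟨insert c₀ B :: l₀, rfl, hg.insert_head hv hc₀' hv₀, by simp⟩
    obtain ⟨D, hD1, hD2, hD3⟩ := hex (l ++ [E]) (by simp) hg
    refine exists_replaceStep_of_greedy hv hτ ht hl ⟨hA, hckA, hcklast⟩ hc₀
      (hv₀ ▸ hposI ck (hAI hckA)) (by simpa using hD1) hD2 ?_
    rw [hD3, halloc, allocated_append]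
    simp
  push Not at hnone
  obtain ⟨z₀, hz₀T, hz₀E, hz₀⟩ := hnone
  set ρ := τ - cost v E with hρ
  have hρck : ρ < v ck := by linarith
  -- a chore of cost `x`, inserted together with `E` before the bundles of `l₂`
  have hinsert : ∀ (c₀ : C) (l₁ l₂ : List (Finset C)), c₀ ∉ t.items → v c₀ ≤ ρ → l = l₁ ++ l₂ →
      (∀ B ∈ l₁, τ < cost v (atLeast v B (v c₀)) + v c₀) →
      (∀ y ∈ t.items.erase ck \ allocated l₁, y ∉ E →
        τ < cost v (atLeast v (insert c₀ E) (v y)) + v y) →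
      ∃ t', ReplaceStep prec v τ t t' := by
    intro c₀ l₁ l₂ hc₀ hv₀ hsplit hfit hlast
    have hc₀' : c₀ ∉ t.items.erase ck := fun hx => hc₀ (Finset.mem_of_mem_erase hx)
    rw [hsplit, greedy_append] at hgl
    have hc₀l : c₀ ∉ allocated l₁ := fun hx => by
      obtain ⟨B, hB, hx⟩ := mem_allocated.1 hx
      exact hc₀' (hgl.1.subset B hB hx)
    have hc₀E : c₀ ∉ E := fun hx => hc₀ (hAI (Finset.mem_of_mem_erase hx))
    have hETl : E ⊆ t.items.erase ck \ allocated l₁ := by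
      rw [← hTE] at hET
      refine hET.trans (Finset.sdiff_subset_sdiff le_rfl ?_)
      rw [hsplit, allocated_append]
      exact Finset.subset_union_left
    refine exists_replaceStep_of_greedy hv hτ ht hl ⟨hA, hckA, hcklast⟩ hc₀ (by linarith)
      (D := l₁ ++ insert c₀ E :: l₂) (by simp [hsplit]; omega) ?_ ?_
    · rw [replaceChore, greedy_append, Finset.insert_sdiff_of_notMem _ hc₀l]
      refine ⟨hgl.1.insert_of_not_fit hc₀' hfit, ⟨⟨Finset.insert_subset_insert _ hETl, ?_, ?_⟩, ?_⟩⟩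
      · rw [cost_insert hc₀E]; linarith
      · intro y hy hyE
        rw [Finset.mem_insert, not_or] at hyE
        exact hlast y (Finset.mem_of_mem_insert_of_ne hy hyE.1) hyE.2
      · refine hgl.2.mono (fun x hx => ?_) fun B hB x hx => ?_
        · rw [Finset.mem_sdiff, Finset.mem_insert, Finset.mem_insert, not_or] at hx
          exact hx.1.resolve_left hx.2.1
        · have h1 := hgl.2.subset B hB hx
          rw [Finset.mem_sdiff, Finset.mem_insert, Finset.mem_insert, not_or]
          refine ⟨Or.inr h1, fun h2 => ?_, fun h2 => ?_⟩
          · rw [h2, Finset.mem_sdiff] at h1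
            exact hc₀' h1.1
          · refine hlA x (Finset.mem_of_mem_erase h2) (mem_allocated.2 ⟨B, ?_, hx⟩)
            simp [hsplit, hB]
    · rw [halloc, hsplit, allocated_append, allocated_append, allocated_cons]
      ext x
      simp only [Finset.mem_union, Finset.mem_insert]
      tauto
  have hmono : ∀ (c₀ : C) (w : ℝ), cost v (atLeast v E w) ≤ cost v (atLeast v (insert c₀ E) w) :=
    fun c₀ w => cost_mono hv fun y hy => by
      rw [mem_atLeast] at hy ⊢
      exact ⟨Finset.mem_insert_of_mem hy.1, hy.2⟩
  have hEck : ∀ x ∈ E, v ck ≤ v x := fun x hx => hckle x (Finset.mem_of_mem_erase hx)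
  by_cases hρs : ρ < 2 * v c
  · -- at most one available chore fits after `E`
    obtain ⟨z, hz, hzmax⟩ := Finset.exists_max_image
      ((T.erase ck).filter (fun y => y ∉ E ∧ cost v E + v y ≤ τ)) v
      ⟨z₀, Finset.mem_filter.2 ⟨hz₀T, hz₀E, hz₀⟩⟩
    obtain ⟨hzT, hzE, hzle⟩ := Finset.mem_filter.1 hz
    obtain ⟨hzI, hzl⟩ := Finset.mem_sdiff.1 (Finset.mem_of_mem_erase hzT)
    -- A copy of the largest fitting chore `z` is rejected by the bundles of `l`, just as `z` was.
    -- After it the room is below `2 v c - v c = v c`, too small for any remaining chore.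
    obtain ⟨c₀, hc₀, hv₀⟩ := hsupply t.items (v z) (hv z)
    refine hinsert c₀ l [] hc₀ (by linarith) (by simp) ?_ ?_
    · rw [hv₀]
      exact hff₁.lt_cost_atLeast_add hzI hzl (hposI z hzI)
    · intro y hy hyE
      rw [hTE] at hy
      rcases lt_or_ge τ (cost v E + v y) with h1 | h1
      · linarith [herase y hy hyE h1, hmono c₀ (v y)]
      · have h2 := hzmax y (Finset.mem_filter.2 ⟨hy, hyE, h1⟩)
        have h3 : atLeast v (insert c₀ E) (v y) = insert c₀ E := atLeast_eq_self fun x hx => by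
          rcases Finset.mem_insert.1 hx with rfl | hx
          · rwa [hv₀]
          · linarith [hEck x hx]
        rw [h3, cost_insert fun hx => hc₀ (hAI (Finset.mem_of_mem_erase hx)), hv₀]
        have h4 := hge y (Finset.mem_sdiff.1 (Finset.mem_of_mem_erase hy)).1
        have h5 := hge z hzI
        linarith
  -- two available chores may fit after `E`
  push Not at hρs
  -- With cost exactly `ρ` the bin is full, so only chores larger than `ρ` still have to be checked.
  obtain ⟨c₀, hc₀, hv₀⟩ := hsupply t.items ρ (by linarith)
  have hc₀E : c₀ ∉ E := fun hx => hc₀ (hAI (Finset.mem_of_mem_erase hx))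
  have hfull : cost v (insert c₀ E) = τ := by rw [cost_insert hc₀E, hv₀]; linarith
  have hfinal : ∀ (l₁ l₂ : List (Finset C)), l = l₁ ++ l₂ →
      (∀ B ∈ l₁, τ < cost v (atLeast v B ρ) + ρ) →
      (∀ y ∈ t.items.erase ck \ allocated l₁, y ∉ E → ρ < v y →
        τ < cost v (atLeast v E (v y)) + v y) → ∃ t', ReplaceStep prec v τ t t' := by
    intro l₁ l₂ hsplit hfit hlast
    refine hinsert c₀ l₁ l₂ hc₀ hv₀.le hsplit (by rwa [hv₀]) fun y hy hyE => ?_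
    rcases lt_or_ge ρ (v y) with h1 | h1
    · linarith [hlast y hy hyE h1, hmono c₀ (v y)]
    · rw [atLeast_eq_self, hfull]
      · linarith [hposI y (Finset.mem_of_mem_erase (Finset.mem_sdiff.1 hy).1)]
      · intro x hx
        rcases Finset.mem_insert.1 hx with rfl | hx
        · rwa [hv₀]
        · linarith [hEck x hx]
  -- Each chore of `E` costs at least `v ck > ρ ≥ 2 v c`; three of them with the room `ρ` would
  -- exceed `8 v c > τ`.
  have hEcard : E.card ≤ 2 := by
    by_contra! h3
    have h1 : E.card • (2 * v c) ≤ cost v E :=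
      Finset.card_nsmul_le_sum _ _ _ fun x hx => by linarith [hEck x hx]
    have h4 : (3 : ℝ) ≤ E.card := by exact_mod_cast h3
    rw [nsmul_eq_mul] at h1
    have h5 := mul_le_mul_of_nonneg_right h4 (by linarith : 0 ≤ 2 * v c)
    linarith
  -- `E` is nonempty because `ck` alone costs at most `μ`. If `E = {e}`, the rest of the part
  -- containing `e` costs at most `μ - v e < v ck`, so `A` would dominate this part.
  have hEtwo : E.card = 2 := by
    rcases Nat.lt_or_ge E.card 2 with h1 | h1
    · exfalso
      rcases Finset.eq_empty_or_nonempty E with h2 | ⟨e, he⟩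
      · rw [h2, cost, Finset.sum_empty] at hcA
        linarith [hxμ ck (hAI hckA)]
      · have hEe : E = {e} := by
          refine (Finset.eq_of_subset_of_card_le (Finset.singleton_subset_iff.2 he) ?_).symm
          rw [Finset.card_singleton]; omega
        have heA := Finset.mem_of_mem_erase he
        obtain ⟨Q, hQ, heQ⟩ := hpart e (hAI heA)
        refine h.undominated A hAmem Q hQ (dominates_of_cost_erase_le hv heA hckA
          (fun h' => hckE (h' ▸ he)) ?_)
        have h3 := cost_erase (v := v) heQ
        have h4 : cost v E = v e := by rw [hEe]; simp [cost]
        linarith [h.parts_le Q hQ]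
    · omega
  obtain ⟨e₁, e₂, hne, hE12, h12⟩ : ∃ e₁ e₂, e₁ ≠ e₂ ∧ E = {e₁, e₂} ∧ v e₂ ≤ v e₁ := by
    obtain ⟨x, y, hxy, h1⟩ := Finset.card_eq_two.1 hEtwo
    rcases le_total (v x) (v y) with h2 | h2
    · exact ⟨y, x, hxy.symm, by rw [h1, Finset.pair_comm], h2⟩
    · exact ⟨x, y, hxy, h1, h2⟩
  have hE1 : e₁ ∈ E := by simp [hE12]
  have hE2 : e₂ ∈ E := by simp [hE12]
  have hsum : v e₁ + v e₂ + ρ = τ := by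
    have : cost v E = v e₁ + v e₂ := by rw [hE12, cost, Finset.sum_pair hne]
    linarith
  -- A part of at most two chores containing an allocated chore would be dominated. So the part of
  -- `b` has at least two further chores, each of cost at least `v c`.
  have hbound : ∀ B ∈ t.bundles, ∀ b ∈ B, v b ≤ μ - 2 * v c := by
    intro B hB b hb
    obtain ⟨Q, hQ, hbQ⟩ := hpart b (h.collection.subset B hB hb)
    have hQI : Q ⊆ t.items := h.complete.subset Q hQ
    have hQμ := h.parts_le Q hQ
    have h3 : 2 < Q.card := by
      by_contra! hle
      obtain ⟨B', hB', hd⟩ := exists_dominates_of_card_le_two hv h.firstFit hQI hle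
        (by linarith) (fun x hx => hposI x (hQI hx)) hbQ (mem_allocated.2 ⟨B, hB, hb⟩)
      exact h.undominated B' hB' Q hQ hd
    have h4 : (Q.erase b).card • v c ≤ cost v (Q.erase b) :=
      Finset.card_nsmul_le_sum _ _ _ fun x hx => hge x (hQI (Finset.mem_of_mem_erase hx))
    have h5 : (2 : ℝ) ≤ (Q.erase b).card := by
      rw [Finset.card_erase_of_mem hbQ]
      exact_mod_cast (by omega : 2 ≤ Q.card - 1)
    rw [nsmul_eq_mul] at h4
    have h6 := mul_le_mul_of_nonneg_right h5 hpos.le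
    linarith [cost_erase (v := v) hbQ]
  -- The full bin goes just before the first bundle that would accept a chore of cost `ρ`, or to the
  -- end if there is none.
  rcases exists_first_split (fun B => cost v (atLeast v B ρ) + ρ ≤ τ) l with h1 |
    ⟨l₁, B, l₂, hl12, hl₁, hfit⟩
  · refine hfinal l [] (by simp) (by simpa using h1) fun y hy hyE hyρ => ?_
    rw [hTE] at hy
    exact herase y hy hyE (by linarith)
  · refine hfinal l₁ (B :: l₂) hl12 (by simpa using hl₁) fun y hy hyE hyρ => ?_
    have hBl : B ∈ l := by simp [hl12]
    have hff₃ := hff₁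
    rw [hl12, firstFit_append] at hff₃
    have hTl₁ : ∀ x ∈ A, x ∈ t.items \ allocated l₁ ∧ x ∉ B := fun x hx => by
      have h2 := hlA x hx
      rw [hl12, allocated_append, allocated_cons, Finset.mem_union, Finset.mem_union, not_or,
        not_or] at h2
      exact ⟨Finset.mem_sdiff.2 ⟨hAI hx, h2.1⟩, h2.2.1⟩
    have hA1 := hTl₁ e₁ (Finset.mem_of_mem_erase hE1)
    have hA2 := hTl₁ e₂ (Finset.mem_of_mem_erase hE2)
    have hAk := hTl₁ ck hckA
    -- With more chores available at the earlier position, one larger than a chore of `E` could have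
    -- spoiled the bin. There is none, so all of `E` counts in the test for `y`, and `v y > ρ`
    -- exceeds the room.
    have key := le_of_room_fits hv hff₃.2.1 h8 hμτ hμ0
      (fun y hy => hxμ y (Finset.mem_sdiff.1 hy).1)
      (hbound B (by simp [ht, hBl])) hA1.1 hA2.1 hAk.1 hA1.2 hA2.2 hAk.2 h12 (hEck e₂ hE2) hρck
      hρs hsum hfit y
      (Finset.sdiff_subset_sdiff (Finset.erase_subset _ _) le_rfl hy)
    rw [atLeast_eq_self]
    · linarith
    · intro x hx
      rw [hE12, Finset.mem_insert, Finset.mem_singleton] at hx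
      rcases hx with rfl | rfl
      · exact key.trans h12
      · exact key

/-! ### The Reduction algorithm -/

/-- The sum of the iteration number and the number of bundles above `τ` never increases: each
replacement lowers the latter and Tidy-Up does not raise it. The share `μ₀` used by each Tidy-Up
never exceeds the original `μ`. -/
lemma ReductionRun.spec (hv : ∀ c, 0 ≤ v c) (hprec : IsUniversalOrdering v prec)
    (hpos : 0 < v c) (hτ : 0 ≤ τ) {t : ChoreTuple C} (ht : Admissible v τ μ c t) {i : ℕ}
    {s : ChoreTuple C} (h : ReductionRun prec v τ c t i s) :
    (∃ μ₀ ≤ μ, ∃ P, IsTidied prec v τ μ₀ c s P) ∧ s.bundles.length ≤ t.bundles.length ∧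
      i + excess v τ s.bundles ≤ t.bundles.length := by
  induction h with
  | init h =>
    obtain ⟨h1, h2, h3⟩ := ht.tidyUp hv hprec hpos h
    exact ⟨h1, h2, by simpa using h3.trans List.countP_le_length⟩
  | step _ hr htu ih =>
    obtain ⟨⟨μ₀, hμ₀, P, hP⟩, h2, h3⟩ := ih
    obtain ⟨h4, h5, h6⟩ := (hP.admissible hv hμ₀).replaceStep hv hτ hr
    obtain ⟨h7, h8, h9⟩ := h4.tidyUp hv hprec hpos htu
    exact ⟨h7, by omega, by omega⟩

lemma ReductionRun.exists_next (hv : ∀ c, 0 ≤ v c) (hprec : IsUniversalOrdering v prec)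
    (hsupply : Supply v) (hpos : 0 < v c) (hτ : 0 ≤ τ) (hμτ : 8 * μ ≤ 7 * τ) {t : ChoreTuple C}
    (ht : Admissible v τ μ c t) {i : ℕ} {s : ChoreTuple C} (h : ReductionRun prec v τ c t i s)
    (hex : HasExcessive prec v τ s) :
    (∃ s₁, ReplaceStep prec v τ s s₁) ∧
      ∀ s₁, ReplaceStep prec v τ s s₁ → ∃ s₂, TidyUp prec v c s₁ s₂ := by
  obtain ⟨⟨μ₀, hμ₀, P, hP⟩, -, -⟩ := h.spec hv hprec hpos hτ ht
  exact ⟨hP.exists_replaceStep hv hprec hsupply hpos (by linarith) hex, fun s₁ hs₁ =>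
    ((hP.admissible hv hμ₀).replaceStep hv hτ hs₁).1.exists_tidyUp hv hprec hpos⟩

lemma ReductionRun.exists_reduction (hv : ∀ c, 0 ≤ v c) (hprec : IsUniversalOrdering v prec)
    (hsupply : Supply v) (hpos : 0 < v c) (hτ : 0 ≤ τ) (hμτ : 8 * μ ≤ 7 * τ) {t : ChoreTuple C}
    (ht : Admissible v τ μ c t) {i : ℕ} {s : ChoreTuple C}
    (h : ReductionRun prec v τ c t i s) : ∃ t', Reduction prec v τ c t t' := by
  induction hm : t.bundles.length - i using Nat.strong_induction_on generalizing i s with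
  | _ m ih =>
    by_cases hex : HasExcessive prec v τ s
    · obtain ⟨⟨s₁, hs₁⟩, h2⟩ := h.exists_next hv hprec hsupply hpos hτ hμτ ht hex
      obtain ⟨s₂, hs₂⟩ := h2 s₁ hs₁
      have hnext := ReductionRun.step h hs₁ hs₂
      have h3 := (hnext.spec hv hprec hpos hτ ht).2.2
      exact ih _ (by omega) hnext rfl
    · exact ⟨s, i, h, hex⟩

lemma cost_le_of_not_hasExcessive (hprec : IsUniversalOrdering v prec) (hτ : 0 ≤ τ)
    {t : ChoreTuple C} (h : ¬ HasExcessive prec v τ t) : ∀ B ∈ t.bundles, cost v B ≤ τ := by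
  intro B hB
  by_contra! hlt
  obtain ⟨ck, hck⟩ := exists_isLastChore hprec hτ hlt
  exact h ⟨B, hB, ck, hlt, hck⟩

/-! ### The supply of new chores -/

section Lift

variable {α : Type*} {w : α → ℝ}

lemma extCost_nonneg (hw : ∀ a, 0 ≤ w a) : ∀ c, 0 ≤ extCost w c
  | .orig a => hw a
  | .new _ x => x.2

/-- For each cost there are infinitely many new chores, told apart by their index, and a finite set
cannot contain them all. -/
lemma supply_extCost (w : α → ℝ) : Supply (extCost w) := by
  intro M x hx
  have hinj : Function.Injective (fun i : ℕ => (Chore.new i ⟨x, hx⟩ : Chore α)) := by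
    intro i j h
    injection h
  obtain ⟨i, hi⟩ := Infinite.exists_notMem_finset (M.preimage _ hinj.injOn)
  exact ⟨.new i ⟨x, hx⟩, by simpa using hi, rfl⟩

lemma orig_injective : Function.Injective (Chore.orig : α → Chore α) := by
  intro a b h
  injection h

lemma cost_image_orig (B : Finset α) : cost (extCost w) (B.image Chore.orig) = cost w B := by
  rw [cost, Finset.sum_image orig_injective.injOn]
  rfl

lemma allocated_map_image (A : List (Finset α)) :
    allocated (A.map (fun B => B.image (Chore.orig : α → Chore α))) =
      (allocated A).image Chore.orig := by
  induction A with
  | nil => simp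
  | cons B l ih => simp [ih, Finset.image_union]

lemma IsBundleCollection.map_image {M : Finset α} {A : List (Finset α)}
    (h : IsBundleCollection M A) : IsBundleCollection (M.image (Chore.orig : α → Chore α))
      (A.map (fun B => B.image Chore.orig)) := by
  refine ⟨fun B' hB' => ?_, ?_⟩
  · obtain ⟨B, hB, rfl⟩ := List.mem_map.1 hB'
    exact Finset.image_subset_image (h.subset B hB)
  · exact h.disjoint.map _ fun _ _ hd => (Finset.disjoint_image orig_injective).2 hd

lemma FirstFit.map_image {l : List (Finset α)} {S : Finset α} (h : FirstFit w τ l S) :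
    FirstFit (extCost w) τ (l.map (fun B => B.image Chore.orig)) (S.image Chore.orig) := by
  induction l generalizing S with
  | nil => trivial
  | cons B l ih =>
    refine ⟨fun x hx hxB hpos => ?_, ?_⟩
    · obtain ⟨a, ha, rfl⟩ := Finset.mem_image.1 hx
      have h1 := h.1 a ha (fun haB => hxB (Finset.mem_image_of_mem _ haB)) hpos
      have h2 : atLeast (extCost w) (B.image Chore.orig) (extCost w (.orig a)) =
          (atLeast w B (w a)).image Chore.orig := by
        rw [atLeast, Finset.filter_image]
        rfl
      rw [h2, cost_image_orig]
      exact h1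
    · have := ih h.2
      rwa [Finset.image_sdiff _ _ orig_injective] at this

/-- First Fit Validity is carried to the larger supply in its `FirstFit` form, which involves only
costs and membership. For the maximin share an upper bound suffices, given by the image of an
optimal partition. -/
lemma FirstFitValid.admissible_lift (hw : ∀ a, 0 ≤ w a) {t : ChoreTuple α}
    (h : FirstFitValid w τ t) (hn : 1 ≤ t.bundles.length) {a : α} (ha : a ∈ t.items)
    (ha' : a ∉ allocated t.bundles) :
    Admissible (extCost w) τ (mms w t.items t.bundles.length) (.orig a) t.lift where
  collection := h.collection.map_image
  firstFit := (h.firstFit hw).map_image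
  mem := Finset.mem_image_of_mem _ ha
  unalloc := by
    rw [ChoreTuple.lift, allocated_map_image, orig_injective.mem_finset_image]
    exact ha'
  length_pos := by simpa [ChoreTuple.lift] using hn
  mms_le := by
    obtain ⟨P, hlen, hP, hle⟩ := exists_partition w t.items hn
    have hcomp : IsComplete t.lift.items (P.map (fun B => B.image Chore.orig)) :=
      { hP.toIsBundleCollection.map_image with
        covers := by rw [allocated_map_image, hP.covers]; rfl }
    have := mms_le (v := extCost w) hcomp (mms_nonneg w t.items t.bundles.length) fun Q' hQ' => by
      obtain ⟨Q, hQ, rfl⟩ := List.mem_map.1 hQ'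
      rw [cost_image_orig]
      exact hle Q hQ
    simpa [ChoreTuple.lift, hlen] using this

end Lift

end ChoreReduction

theorem mainTheorem2 {α : Type*} (v : α → ℝ) (hv : ∀ c, 0 ≤ v c) (τ : ℝ)
    (t : ChoreReduction.ChoreTuple α) (ht : ChoreReduction.FirstFitValid v τ t)
    (hn : 1 ≤ t.bundles.length) (c : α) (hc : c ∈ t.items)
    (hc_unalloc : c ∉ ChoreReduction.allocated t.bundles) (hc_pos : 0 < v c)
    (μ : ℝ) (hμ : ChoreReduction.mms v t.items t.bundles.length = μ) (hτ : 8 / 7 * μ ≤ τ)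
    (prec : ChoreReduction.Chore α → ChoreReduction.Chore α → Prop)
    (hprec : ChoreReduction.IsUniversalOrdering (ChoreReduction.extCost v) prec) :
    -- the algorithm never gets stuck and stops after at most `n` iterations
    ((∃ s, ChoreReduction.TidyUp prec (ChoreReduction.extCost v) (.orig c) t.lift s) ∧
      ∀ i s, ChoreReduction.ReductionRun prec (ChoreReduction.extCost v) τ (.orig c) t.lift i s →
        i ≤ t.bundles.length ∧
        (ChoreReduction.HasExcessive prec (ChoreReduction.extCost v) τ s →
          (∃ s₁, ChoreReduction.ReplaceStep prec (ChoreReduction.extCost v) τ s s₁) ∧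
          ∀ s₁, ChoreReduction.ReplaceStep prec (ChoreReduction.extCost v) τ s s₁ →
            ∃ s₂, ChoreReduction.TidyUp prec (ChoreReduction.extCost v) (.orig c) s₁ s₂)) ∧
    -- every output has the claimed properties
    (∃ t', ChoreReduction.Reduction prec (ChoreReduction.extCost v) τ (.orig c) t.lift t') ∧
    ∀ t', ChoreReduction.Reduction prec (ChoreReduction.extCost v) τ (.orig c) t.lift t' →
      ChoreReduction.FirstFitValid (ChoreReduction.extCost v) τ t' ∧
      (1 ≤ t'.bundles.length ∧ t'.bundles.length ≤ t.bundles.length) ∧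
      ChoreReduction.mms (ChoreReduction.extCost v) t'.items t'.bundles.length ≤ μ ∧
      (.orig c ∈ t'.items ∧ .orig c ∉ ChoreReduction.allocated t'.bundles) ∧
      (∀ B ∈ t'.bundles, ChoreReduction.cost (ChoreReduction.extCost v) B ≤ τ) ∧
      ChoreReduction.IsFFDOutput (ChoreReduction.extCost v) t'.items τ t'.bundles.length
        t'.bundles := by
  subst hμ
  have hv' := ChoreReduction.extCost_nonneg hv
  have hpos : 0 < ChoreReduction.extCost v (.orig c) := hc_pos
  have hμ0 := ChoreReduction.mms_nonneg v t.items t.bundles.length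
  have hτ0 : 0 ≤ τ := hμ0.trans ht.threshold
  have hμτ : 8 * ChoreReduction.mms v t.items t.bundles.length ≤ 7 * τ := by linarith
  have hsupply := ChoreReduction.supply_extCost v
  have hadm := ht.admissible_lift hv hn hc hc_unalloc
  have hlen : t.lift.bundles.length = t.bundles.length := by simp [ChoreReduction.ChoreTuple.lift]
  obtain ⟨s₀, hs₀⟩ := hadm.exists_tidyUp hv' hprec hpos
  refine ⟨⟨⟨s₀, hs₀⟩, fun i s hs => ⟨?_, fun hex =>
    hs.exists_next hv' hprec hsupply hpos hτ0 hμτ hadm hex⟩⟩,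
    (ChoreReduction.ReductionRun.init hs₀).exists_reduction hv' hprec hsupply hpos hτ0 hμτ hadm, ?_⟩
  · have := (hs.spec hv' hprec hpos hτ0 hadm).2.2
    omega
  · rintro t' ⟨i, hrun, hex⟩
    obtain ⟨⟨μ₀, hμ₀, P, hP⟩, hle, -⟩ := hrun.spec hv' hprec hpos hτ0 hadm
    have h := hP.admissible hv' hμ₀
    have hcost := ChoreReduction.cost_le_of_not_hasExcessive hprec hτ0 hex
    refine ⟨h.firstFit.firstFitValid hv' h.collection (h.mms_le.trans ht.threshold),
      ⟨h.length_pos, by omega⟩, h.mms_le, ⟨h.mem, h.unalloc⟩, hcost, ?_⟩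
    -- Every chore of the output costs at least `v c > 0` and no bundle exceeds `τ`, so the first
    -- fit list is greedy and hence an output of FFD.
    exact (h.firstFit.greedy (fun x hx => hpos.trans_le (hP.ge x hx)) h.collection.subset
      h.collection.disjoint hcost).isFFDOutput hv'
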